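/- Work over $\mathbb C$. Let $\mathfrak g=\mathfrak{sl}(\infty)=\bigcup_{n\ge1}\mathfrak{sl}(n)$ be the Lie algebra of finitary traceless matrices indexed by $\mathbb Z_{>0}$, with $\mathfrak h$ the diagonal Cartan subalgebra, roots $\varepsilon_i-\varepsilon_j$ ($i\ne j$) and root vectors $E_{ij}$. Here $\mathfrak{sl}(n)$ consists of the matrices supported on $\mathbb Z_n=\{1,\dots,n\}$. A weight module means an $\mathfrak h$-weight module with finite-dimensional weight spaces. **Orders and parabolic subalgebras.** Let $\prec$ be a (strict) partial order on a set $F$, equal to $\mathbb Z_{>0}$ or $\mathbb Z_n$, and put $[i]=\{i\}\cup\{j: i,j\text{ not comparable}\}$. The order is *admissible* if $[i]\neq[j]$ implies $[i]\cap[j]=\emptyset$. Let $\mathfrak p(\prec)$ be generated by the Cartan subalgebra and all $E_{ij}$ with $i\ne j$ and either $i\prec j$ or $i,j$ not comparable; let $\mathfrak l(\prec)$ be generated by the Cartan subalgebra and all $E_{ij}$ with $i\ne j$ not comparable; let $\mathfrak u(\prec)$ be generated by all $E_{ij}$ with $i\prec j$. **Aligned modules.** A simple weight module $M$ over $\mathfrak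 s=\mathfrak{sl}(\infty)$ (resp. $\mathfrak s=\mathfrak{sl}(n)$) is *$\mathfrak p(\prec)$-aligned* if it is a simple quotient of $\mathbf U(\mathfrak s)\otimes_{\mathbf U(\mathfrak p(\prec))}S$ for some simple weight $\mathfrak l(\prec)$-module $S$ on which $\mathfrak u(\prec)$ is made to act by $0$. For an order $\prec$ on $\mathbb Z_{>0}$ let $\prec_n$ be its restriction to $\mathbb Z_n$. A simple weight $\mathfrak g$-module $M$ is *pseudo $\mathfrak p(\prec)$-aligned* if it is not $\mathfrak p(\prec)$-aligned, but is the direct limit $\varinjlim_n M_n$ (an increasing union) of $\mathfrak{sl}(n)$-submodules $M_n$, $n\ge1$, where each $M_n$ is a simple $\mathfrak p(\prec_n)$-aligned $\mathfrak{sl}(n)$-module. **The modules $X_{\mathfrak{sl}}(\mu)$.** For $\mu\in\mathbb C^{F}$ let $\mathrm{Int}(\mu)$, $\mathrm{Int}^+(\mu)$, $\mathrm{Int}^-(\mu)$ be the sets of $i\in F$ with $\mu_i\in\mathbb Z$, $\mu_i\in\mathbb Z_{\ge0}$, $\mu_i\in\mathbb Z_{<0}$, and let $Q$ be the root lattice,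 the $\mathbb Z$-span of the $\varepsilon_i-\varepsilon_j$. Let $E_{ij}$ act on formal monomials $\mathbf x^\lambda$, $\lambda\in\mathbb C^F$, by $x_i\partial_j$. Put $V_{\mathfrak{sl}}(\mu)=\mathrm{span}\{\mathbf x^\lambda:\lambda-\mu\in Q,\ \mathrm{Int}^+(\mu)\subseteq\mathrm{Int}^+(\lambda)\}$, let $V_{\mathfrak{sl}}(\mu)^+$ be the sum of all $V_{\mathfrak{sl}}(\mu')$ with $\mu'-\mu\in Q$ and $\mathrm{Int}^+(\mu)\subsetneq\mathrm{Int}^+(\mu')$, and let $X_{\mathfrak{sl}}(\mu)=V_{\mathfrak{sl}}(\mu)/V_{\mathfrak{sl}}(\mu)^+$. For $\mu\in\mathbb C^{\mathbb Z_{>0}}$ put $\mu^n=(\mu_1,\dots,\mu_n)$, so that $X_{\mathfrak{sl}}(\mu^n)$ is an $\mathfrak{sl}(n)$-module. **Compatibility.** For $\eta\in\mathbb C^n$ let $\prec_\eta$ be the order on $\mathbb Z_n$ given by the shadow of $X_{\mathfrak{sl}}(\eta)$: $i\prec_\eta j$ if and only if $i\neq j$ and, for the weights $\lambda$ of $X_{\mathfrak{sl}}(\eta)$,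 the set of real $q$ such that $\lambda+q(\varepsilon_i-\varepsilon_j)$ is a weight of $X_{\mathfrak{sl}}(\eta)$ is bounded from above but not from below. For subsets $A,B$ write $A\preceq B$ if for all $a\in A$, $b\in B$ either $a\prec b$ or $[a]=[b]$. An admissible partial order $\prec$ on $\mathbb Z_n$ is *$\mathfrak{sl}$-compatible with $\eta$* if it coincides with $\prec_\eta$ on $I=\mathbb Z_n\setminus\mathrm{Int}(\eta)$ (which amounts to the elements of $I$ being pairwise not comparable), and $\mathrm{Int}^-(\eta)\preceq I$, $I\preceq\mathrm{Int}^+(\eta)$ and $\mathrm{Int}^-(\eta)\preceq\mathrm{Int}^+(\eta)$. An admissible partial order $\prec$ on $\mathbb Z_{>0}$ is *locally $\mathfrak{sl}$-compatible with $\mu$* if $\prec_n$ is $\mathfrak{sl}$-compatible with $\mu^n$ for every $n\ge1$. **Proposition.** Let $\prec$ be an admissible partial order on $\mathbb Z_{>0}$ and let $\mu\in\mathbb C^{\mathbb Z_{>0}}$. Then $X_{\mathfrak{sl}}(\mu)$ is pseudo $\mathfrak p(\prec)$-aligned if and only if $\prec$ is locally $\mathfrak{sl}$-compatible with $\mu$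 and $X_{\mathfrak{sl}}(\mu)$ is not $\mathfrak p(\prec)$-aligned. Moreover, for every $n\ge1$, the $\mathfrak{sl}(n)$-module $X_{\mathfrak{sl}}(\mu^n)$ is $\mathfrak p(\prec_n)$-aligned if and only if $\prec_n$ is $\mathfrak{sl}$-compatible with $\mu^n$. -/

import Mathlib

open scoped TensorProduct

noncomputable section

namespace SlModules

/-! ### The Lie algebra of finitary traceless matrices

For `ι = Fin n` this is `sl(n)`, and for `ι = ℕ` (which indexes the positive integers, with `0`
standing for the first one) it is `sl(∞)`. -/

section LieAlg

variable {ι : Type}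

/-- The vector space with basis `e_k`, `k ∈ ι`. -/
def Vec (ι : Type) : Type := ι →₀ ℂ

instance : AddCommGroup (Vec ι) := inferInstanceAs (AddCommGroup (ι →₀ ℂ))

instance : Module ℂ (Vec ι) := inferInstanceAs (Module ℂ (ι →₀ ℂ))

/-- The basis vector `e_k`. -/
def Vec.e (k : ι) : Vec ι := Finsupp.single k (1 : ℂ)

/-- The `k`-th coordinate of a vector. -/
def Vec.coord (k : ι) : Vec ι →ₗ[ℂ] ℂ where
  toFun v := (show ι →₀ ℂ from v) k
  map_add' _ _ := rfl
  map_smul' _ _ := rfl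

theorem Vec.coord_e_same (k : ι) : Vec.coord k (Vec.e k) = 1 := Finsupp.single_eq_same

theorem Vec.coord_e_ne {k l : ι} (h : k ≠ l) : Vec.coord k (Vec.e l) = 0 :=
  Finsupp.single_eq_of_ne h

theorem Vec.ext {v w : Vec ι} (h : ∀ k, Vec.coord k v = Vec.coord k w) : v = w := Finsupp.ext h

/-- The elementary matrix `E_ij`, as the operator `e_j ↦ e_i`, `e_k ↦ 0` for `k ≠ j`. -/
def E (i j : ι) : Module.End ℂ (Vec ι) := (Vec.coord j).smulRight (Vec.e i)

theorem E_apply (i j : ι) (v : Vec ι) : E i j v = Vec.coord j v • Vec.e i := rfl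

theorem E_mul_same (i j l : ι) : E i j * E j l = E i l := by
  refine LinearMap.ext fun v => ?_
  rw [Module.End.mul_apply, E_apply, E_apply, E_apply, map_smul, Vec.coord_e_same, smul_eq_mul,
    mul_one]

theorem E_mul_ne (i l : ι) {j k : ι} (h : j ≠ k) : E i j * E k l = 0 := by
  refine LinearMap.ext fun v => ?_
  rw [Module.End.mul_apply, E_apply, E_apply, map_smul, Vec.coord_e_ne h, smul_zero, zero_smul,
    LinearMap.zero_apply]

/-- The family of all elementary matrices. -/
def Efam (ι : Type) (p : ι × ι) : Module.End ℂ (Vec ι) := E p.1 p.2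

theorem E_comm [DecidableEq ι] (i j k l : ι) :
    E i j * E k l - E k l * E i j =
      (if j = k then E i l else 0) - (if l = i then E k j else 0) := by
  congr 1
  · split_ifs with h
    · subst h; exact E_mul_same _ _ _
    · exact E_mul_ne _ _ h
  · split_ifs with h
    · subst h; exact E_mul_same _ _ _
    · exact E_mul_ne _ _ h

/-- The matrix entry `A_ij`. -/
def matEntry (i j : ι) : Module.End ℂ (Vec ι) →ₗ[ℂ] ℂ :=
  Vec.coord i ∘ₗ LinearMap.applyₗ (Vec.e j)

theorem matEntry_E_same (i j : ι) : matEntry i j (E i j) = 1 := by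
  change Vec.coord i (E i j (Vec.e j)) = 1
  rw [E_apply, Vec.coord_e_same, one_smul, Vec.coord_e_same]

theorem matEntry_E_ne {p q : ι × ι} (h : p ≠ q) : matEntry p.1 p.2 (Efam ι q) = 0 := by
  change Vec.coord p.1 (E q.1 q.2 (Vec.e p.2)) = 0
  rw [E_apply, map_smul]
  by_cases h1 : p.1 = q.1
  · have h2 : q.2 ≠ p.2 := fun h2 => h (Prod.ext h1 h2.symm)
    rw [Vec.coord_e_ne h2, zero_smul]
  · rw [Vec.coord_e_ne h1, smul_zero]

theorem linearIndependent_Efam (ι : Type) : LinearIndependent ℂ (Efam ι) := by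
  refine linearIndependent_iff.mpr fun c hc => Finsupp.ext fun p => ?_
  have h := congrArg (matEntry p.1 p.2) hc
  rw [Finsupp.linearCombination_apply, map_finsuppSum, map_zero, Finsupp.sum,
    Finset.sum_eq_single p] at h
  · rw [map_smul, show matEntry p.1 p.2 (Efam ι p) = 1 from matEntry_E_same _ _, smul_eq_mul,
      mul_one] at h
    exact h
  · intro q _ hq
    rw [map_smul, matEntry_E_ne hq.symm, smul_zero]
  · intro hp
    rw [Finsupp.notMem_support_iff.mp hp, zero_smul, map_zero]

/-- The generators of `sl`: the root vectors `E_ij` (`i ≠ j`) and the coroots `E_ii - E_jj`. -/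
def slGen (ι : Type) : Set (Module.End ℂ (Vec ι)) :=
  {A | ∃ i j : ι, i ≠ j ∧ A = E i j} ∪ {A | ∃ i j : ι, A = E i i - E j j}

theorem E_comm_mem (i j k l : ι) :
    E i j * E k l - E k l * E i j ∈ Submodule.span ℂ (slGen ι) := by
  classical
  rw [E_comm]
  by_cases h1 : j = k <;> by_cases h2 : l = i
  · subst h1; subst h2
    rw [if_pos rfl, if_pos rfl]
    exact Submodule.subset_span (Or.inr ⟨_, _, rfl⟩)
  · have : (if j = k then E i l else 0) - (if l = i then E k j else 0) = E i l := by simp [h1, h2]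
    rw [this]
    exact Submodule.subset_span (Or.inl ⟨_, _, Ne.symm h2, rfl⟩)
  · have : (if j = k then E i l else 0) - (if l = i then E k j else 0) = -E k j := by
      simp [h1, h2]
    rw [this]
    exact Submodule.neg_mem _ (Submodule.subset_span (Or.inl ⟨_, _, Ne.symm h1, rfl⟩))
  · have : (if j = k then E i l else 0) - (if l = i then E k j else 0) = 0 := by simp [h1, h2]
    rw [this]
    exact Submodule.zero_mem _

theorem slGen_span_le (ι : Type) :
    Submodule.span ℂ (slGen ι) ≤ Submodule.span ℂ (Set.range (Efam ι)) := by
  refine Submodule.span_le.mpr ?_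
  rintro A (⟨i, j, -, rfl⟩ | ⟨i, j, rfl⟩)
  · exact Submodule.subset_span (Set.mem_range_self (f := Efam ι) (i, j))
  · exact Submodule.sub_mem _ (Submodule.subset_span (Set.mem_range_self (f := Efam ι) (i, i)))
      (Submodule.subset_span (Set.mem_range_self (f := Efam ι) (j, j)))

theorem comm_mem' {A B : Module.End ℂ (Vec ι)}
    (hA : A ∈ Submodule.span ℂ (Set.range (Efam ι)))
    (hB : B ∈ Submodule.span ℂ (Set.range (Efam ι))) :
    A * B - B * A ∈ Submodule.span ℂ (slGen ι) := by
  refine Submodule.span_induction₂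
    (p := fun A B _ _ => A * B - B * A ∈ Submodule.span ℂ (slGen ι))
    ?_ ?_ ?_ ?_ ?_ ?_ ?_ hA hB
  · rintro _ _ ⟨p, rfl⟩ ⟨q, rfl⟩; exact E_comm_mem _ _ _ _
  · intro y _; simp
  · intro y _; simp
  · intro x y z _ _ _ h1 h2
    have e : (x + y) * z - z * (x + y) = (x * z - z * x) + (y * z - z * y) := by noncomm_ring
    rw [e]; exact Submodule.add_mem _ h1 h2
  · intro x y z _ _ _ h1 h2
    have e : x * (y + z) - (y + z) * x = (x * y - y * x) + (x * z - z * x) := by noncomm_ring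
    rw [e]; exact Submodule.add_mem _ h1 h2
  · intro r x y _ _ h
    have e : (r • x) * y - y * (r • x) = r • (x * y - y * x) := by
      rw [smul_mul_assoc, mul_smul_comm, smul_sub]
    rw [e]; exact Submodule.smul_mem _ r h
  · intro r x y _ _ h
    have e : x * (r • y) - (r • y) * x = r • (x * y - y * x) := by
      rw [smul_mul_assoc, mul_smul_comm, smul_sub]
    rw [e]; exact Submodule.smul_mem _ r h

theorem comm_mem {A B : Module.End ℂ (Vec ι)} (hA : A ∈ Submodule.span ℂ (slGen ι))
    (hB : B ∈ Submodule.span ℂ (slGen ι)) : A * B - B * A ∈ Submodule.span ℂ (slGen ι) :=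
  comm_mem' (slGen_span_le ι hA) (slGen_span_le ι hB)

/-- The space of finitary traceless `ι × ι` matrices: the span of the matrices `E_ij` (`i ≠ j`) and
`E_ii - E_jj`. -/
def slSub (ι : Type) : Submodule ℂ (Module.End ℂ (Vec ι)) := Submodule.span ℂ (slGen ι)

/-- The Lie algebra `sl(ι)` of finitary traceless `ι × ι` matrices, with the commutator bracket. -/
def sl (ι : Type) : Type := slSub ι

/-- The underlying matrix of an element of `sl(ι)`. -/
def sl.mat (A : sl ι) : Module.End ℂ (Vec ι) := A.1

theorem sl.ext {A B : sl ι} (h : A.mat = B.mat) : A = B := Subtype.ext h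

instance : AddCommGroup (sl ι) := inferInstanceAs (AddCommGroup (slSub ι))

instance : Module ℂ (sl ι) := inferInstanceAs (Module ℂ (slSub ι))

/-- The bracket is the commutator of matrices. -/
instance : Bracket (sl ι) (sl ι) :=
  ⟨fun A B => ⟨A.mat * B.mat - B.mat * A.mat, comm_mem A.2 B.2⟩⟩

theorem sl.mat_add (A B : sl ι) : (A + B).mat = A.mat + B.mat := rfl

theorem sl.mat_zero : (0 : sl ι).mat = 0 := rfl

theorem sl.mat_smul (c : ℂ) (A : sl ι) : (c • A).mat = c • A.mat := rfl

theorem sl.mat_lie (A B : sl ι) : ⁅A, B⁆.mat = A.mat * B.mat - B.mat * A.mat := rfl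

instance : LieRing (sl ι) where
  add_lie A B C := sl.ext (by simp only [sl.mat_lie, sl.mat_add]; noncomm_ring)
  lie_add A B C := sl.ext (by simp only [sl.mat_lie, sl.mat_add]; noncomm_ring)
  lie_self A := sl.ext (by rw [sl.mat_lie, sub_self, sl.mat_zero])
  leibniz_lie A B C := sl.ext (by simp only [sl.mat_lie, sl.mat_add]; noncomm_ring)

instance : LieAlgebra ℂ (sl ι) where
  lie_smul c A B := sl.ext (by
    rw [sl.mat_lie, sl.mat_smul, sl.mat_smul, sl.mat_lie, smul_mul_assoc, mul_smul_comm, smul_sub])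

/-- The inclusion of `sl(ι)` into all matrices, as a linear map. -/
def sl.matLin (ι : Type) : sl ι →ₗ[ℂ] Module.End ℂ (Vec ι) where
  toFun := sl.mat
  map_add' := sl.mat_add
  map_smul' := sl.mat_smul

/-- The root vector `E_ij ∈ sl(ι)`, of root `ε_i - ε_j`. -/
def rootVec (i j : ι) (h : i ≠ j) : sl ι :=
  ⟨E i j, Submodule.subset_span (Or.inl ⟨i, j, h, rfl⟩)⟩

/-- The coroot `E_ii - E_jj ∈ sl(ι)`. -/
def coroot (i j : ι) : sl ι :=
  ⟨E i i - E j j, Submodule.subset_span (Or.inr ⟨i, j, rfl⟩)⟩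

/-- The fixed Cartan subalgebra `𝔥` of `sl(ι)`: the diagonal matrices. -/
def cartan (ι : Type) : Submodule ℂ (sl ι) :=
  Submodule.span ℂ {H | ∃ i j : ι, H = coroot i j}

/-- The diagonal entry `A ↦ A_ii`; this is `ε_i` on `sl(ι)`. -/
def diagEntry (i : ι) : sl ι →ₗ[ℂ] ℂ :=
  matEntry i i ∘ₗ sl.matLin ι

/-- The root `ε_i - ε_j` as a functional on the Cartan subalgebra. -/
def root (i j : ι) : Module.Dual ℂ (cartan ι) :=
  (diagEntry i - diagEntry j) ∘ₗ (cartan ι).subtype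

end LieAlg

/-! ### Weight modules -/

section Weight

variable {L : Type} [LieRing L] [LieAlgebra ℂ L]

/-- The weight space of weight `χ` of a module, relative to a subspace `H` of the Lie algebra. -/
def weightSpace (H : Submodule ℂ L) (M : Type) [AddCommGroup M] [Module ℂ M] [LieRingModule L M]
    [LieModule ℂ L M] (χ : Module.Dual ℂ H) : Submodule ℂ M where
  carrier := {m | ∀ x : H, ⁅(x : L), m⁆ = χ x • m}
  add_mem' ha hb x := by rw [lie_add, ha x, hb x, smul_add]
  zero_mem' x := by simp
  smul_mem' c m hm x := by rw [lie_smul, hm x, smul_comm]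

/-- A weight module with finite-dimensional weight spaces. (The sum of the weight spaces is
automatically direct.) -/
def IsWeightModule (H : Submodule ℂ L) (M : Type) [AddCommGroup M] [Module ℂ M]
    [LieRingModule L M] [LieModule ℂ L M] : Prop :=
  (⨆ χ : Module.Dual ℂ H, weightSpace H M χ = ⊤) ∧
    ∀ χ : Module.Dual ℂ H, FiniteDimensional ℂ (weightSpace H M χ)

/-- The support of a module: the set of its weights. -/
def support (H : Submodule ℂ L) (M : Type) [AddCommGroup M] [Module ℂ M] [LieRingModule L M]
    [LieModule ℂ L M] : Set (Module.Dual ℂ H) :=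
  {χ | weightSpace H M χ ≠ ⊥}

end Weight

/-! ### Generalized Verma modules -/

section Verma

attribute [local instance 100] LieRing.ofAssociativeRing

variable {L : Type} [LieRing L] [LieAlgebra ℂ L] (P : LieSubalgebra ℂ L)
variable (S : Type) [AddCommGroup S] [Module ℂ S] [LieRingModule P S] [LieModule ℂ P S]

/-- The relations `u p ⊗ s = u ⊗ p s` defining `U(L) ⊗_{U(P)} S` as a quotient of `U(L) ⊗ S`. -/
def vermaRel : Submodule (UniversalEnvelopingAlgebra ℂ L) (UniversalEnvelopingAlgebra ℂ L ⊗[ℂ] S) :=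
  Submodule.span _ {t | ∃ (u : UniversalEnvelopingAlgebra ℂ L) (p : P) (s : S),
    t = (u * UniversalEnvelopingAlgebra.ι ℂ (p : L)) ⊗ₜ[ℂ] s - u ⊗ₜ[ℂ] ⁅p, s⁆}

/-- The induced module `U(L) ⊗_{U(P)} S`. -/
def GenVerma : Type := (UniversalEnvelopingAlgebra ℂ L ⊗[ℂ] S) ⧸ vermaRel P S

instance : AddCommGroup (GenVerma P S) := inferInstanceAs (AddCommGroup (_ ⧸ vermaRel P S))

instance : Module (UniversalEnvelopingAlgebra ℂ L) (GenVerma P S) :=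
  inferInstanceAs (Module (UniversalEnvelopingAlgebra ℂ L) (_ ⧸ vermaRel P S))

instance : Module ℂ (GenVerma P S) := inferInstanceAs (Module ℂ (_ ⧸ vermaRel P S))

instance : IsScalarTower ℂ (UniversalEnvelopingAlgebra ℂ L) (GenVerma P S) :=
  inferInstanceAs (IsScalarTower ℂ (UniversalEnvelopingAlgebra ℂ L) (_ ⧸ vermaRel P S))

instance : LieRingModule L (GenVerma P S) where
  bracket x m := UniversalEnvelopingAlgebra.ι ℂ x • m
  add_lie x y m := by
    rw [map_add, add_smul]
  lie_add x m n := smul_add _ m n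
  leibniz_lie x y m := by
    change UniversalEnvelopingAlgebra.ι ℂ x • UniversalEnvelopingAlgebra.ι ℂ y • m =
      UniversalEnvelopingAlgebra.ι ℂ ⁅x, y⁆ • m +
        UniversalEnvelopingAlgebra.ι ℂ y • UniversalEnvelopingAlgebra.ι ℂ x • m
    rw [LieHom.map_lie, LieRing.of_associative_ring_bracket, sub_smul, mul_smul, mul_smul, sub_add_cancel]

instance : LieModule ℂ L (GenVerma P S) where
  smul_lie t x m := by
    change UniversalEnvelopingAlgebra.ι ℂ (t • x) • m = t • UniversalEnvelopingAlgebra.ι ℂ x • m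
    rw [map_smul, smul_assoc]
  lie_smul t x m := by
    change UniversalEnvelopingAlgebra.ι ℂ x • t • m = t • UniversalEnvelopingAlgebra.ι ℂ x • m
    rw [smul_comm]

end Verma

/-! ### Partial orders and parabolic subalgebras -/

section Orders

variable {ι : Type}

/-- The set `[i]` consisting of `i` and of all elements not comparable with `i`. -/
def cls (r : ι → ι → Prop) (i : ι) : Set ι := {i} ∪ {j | ¬ r i j ∧ ¬ r j i}

/-- Admissible partial orders: distinct sets `[i]`, `[j]` are disjoint. -/
def Admissible (r : ι → ι → Prop) : Prop :=
  ∀ i j, cls r i ≠ cls r j → cls r i ∩ cls r j = ∅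

/-- The parabolic subalgebra `𝔭(≺)`, generated by `𝔥` and the root spaces of all `ε_i - ε_j` that
are positive (`i ≺ j`) or not comparable with zero. -/
def parabolic (r : ι → ι → Prop) : LieSubalgebra ℂ (sl ι) :=
  LieSubalgebra.lieSpan ℂ (sl ι)
    ((cartan ι : Set (sl ι)) ∪ {x | ∃ (i j : ι) (h : i ≠ j),
      (r i j ∨ (¬ r i j ∧ ¬ r j i)) ∧ x = rootVec i j h})

/-- The reductive component `𝔩(≺)`, generated by `𝔥` and the root spaces of all `ε_i - ε_j` that
are not comparable with zero. -/
def levi (r : ι → ι → Prop) : LieSubalgebra ℂ (sl ι) :=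
  LieSubalgebra.lieSpan ℂ (sl ι)
    ((cartan ι : Set (sl ι)) ∪ {x | ∃ (i j : ι) (h : i ≠ j),
      (¬ r i j ∧ ¬ r j i) ∧ x = rootVec i j h})

/-- The locally nilpotent radical `𝔲(≺)`, generated by the root spaces of all `ε_i - ε_j` with
`i ≺ j`. -/
def nilradical (r : ι → ι → Prop) : LieSubalgebra ℂ (sl ι) :=
  LieSubalgebra.lieSpan ℂ (sl ι) {x | ∃ (i j : ι) (h : i ≠ j), r i j ∧ x = rootVec i j h}

end Orders

/-! ### Aligned modules -/

section Aligned

variable {ι : Type}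

/-- `S` is a `𝔭(≺)`-module on which `𝔲(≺)` acts by zero and which is simple, and a weight module,
as a module over `𝔩(≺)`. (Such `S` are the simple weight `𝔩(≺)`-modules, extended to `𝔭(≺)` by
letting `𝔲(≺)` act by zero.) -/
structure IsInducing (r : ι → ι → Prop) (S : Type) [AddCommGroup S] [Module ℂ S]
    [LieRingModule (parabolic r) S] [LieModule ℂ (parabolic r) S] : Prop where
  nilradical_lie : ∀ x : parabolic r, (x : sl ι) ∈ nilradical r → ∀ s : S, ⁅x, s⁆ = 0
  nontrivial : Nontrivial S
  simple : ∀ W : Submodule ℂ S,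
    (∀ x : parabolic r, (x : sl ι) ∈ levi r → ∀ s ∈ W, ⁅x, s⁆ ∈ W) → W = ⊥ ∨ W = ⊤
  weight : IsWeightModule ((cartan ι).comap ((parabolic r).incl : parabolic r →ₗ[ℂ] sl ι)) S

/-- A simple weight `sl(ι)`-module `M` is `𝔭(≺)`-aligned if it is (isomorphic to) the simple
quotient of a generalized Verma module `U(sl(ι)) ⊗_{U(𝔭(≺))} S`. -/
def IsAligned (r : ι → ι → Prop) (M : Type) [AddCommGroup M] [Module ℂ M]
    [LieRingModule (sl ι) M] [LieModule ℂ (sl ι) M] : Prop :=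
  LieModule.IsIrreducible ℂ (sl ι) M ∧ IsWeightModule (cartan ι) M ∧
    ∃ (S : Type) (_ : AddCommGroup S) (_ : Module ℂ S) (_ : LieRingModule (parabolic r) S)
      (_ : LieModule ℂ (parabolic r) S),
      IsInducing r S ∧ ∃ f : GenVerma (parabolic r) S →ₗ⁅ℂ, sl ι⁆ M, Function.Surjective f

end Aligned

/-! ### Restriction along `sl(n) ⊆ sl(∞)` and pseudo aligned modules -/

section Pseudo

/-- The linear map `e_k ↦ e_{f(k)}`. -/
def Vec.push {ι κ : Type} (f : ι ↪ κ) : Vec ι →ₗ[ℂ] Vec κ where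
  toFun v := Finsupp.mapDomain f v
  map_add' _ _ := Finsupp.mapDomain_add
  map_smul' _ _ := Finsupp.mapDomain_smul _ _

/-- The restriction of a vector to the coordinates in the range of `f`. -/
def Vec.pull {ι κ : Type} (f : ι ↪ κ) : Vec κ →ₗ[ℂ] Vec ι where
  toFun v := Finsupp.comapDomain f v f.injective.injOn
  map_add' v w := Finsupp.comapDomain_add_of_injective f.injective v w
  map_smul' c v := Finsupp.comapDomain_smul_of_injective f.injective c v

theorem Vec.pull_push {ι κ : Type} (f : ι ↪ κ) (v : Vec ι) : Vec.pull f (Vec.push f v) = v :=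
  Finsupp.comapDomain_mapDomain f f.injective v

theorem Vec.push_e {ι κ : Type} (f : ι ↪ κ) (k : ι) : Vec.push f (Vec.e k) = Vec.e (f k) :=
  Finsupp.mapDomain_single

theorem Vec.coord_pull {ι κ : Type} (f : ι ↪ κ) (k : ι) (v : Vec κ) :
    Vec.coord k (Vec.pull f v) = Vec.coord (f k) v := rfl

/-- Extension of matrices by zero along an injection `f : ι ↪ κ`, so that
`E_ij ↦ E_{f(i) f(j)}`. -/
def extendEnd {ι κ : Type} (f : ι ↪ κ) : Module.End ℂ (Vec ι) →ₗ[ℂ] Module.End ℂ (Vec κ) where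
  toFun A := Vec.push f ∘ₗ A ∘ₗ Vec.pull f
  map_add' A B := by rw [LinearMap.add_comp, LinearMap.comp_add]
  map_smul' c A := by rw [LinearMap.smul_comp, LinearMap.comp_smul, RingHom.id_apply]

theorem extendEnd_apply {ι κ : Type} (f : ι ↪ κ) (A : Module.End ℂ (Vec ι)) (v : Vec κ) :
    extendEnd f A v = Vec.push f (A (Vec.pull f v)) := rfl

theorem extendEnd_mul {ι κ : Type} (f : ι ↪ κ) (A B : Module.End ℂ (Vec ι)) :
    extendEnd f (A * B) = extendEnd f A * extendEnd f B := by
  refine LinearMap.ext fun v => ?_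
  rw [Module.End.mul_apply, extendEnd_apply, extendEnd_apply, extendEnd_apply, Vec.pull_push,
    Module.End.mul_apply]

theorem extendEnd_E {ι κ : Type} (f : ι ↪ κ) (i j : ι) :
    extendEnd f (E i j) = E (f i) (f j) := by
  refine LinearMap.ext fun v => ?_
  rw [extendEnd_apply, E_apply, E_apply, map_smul, Vec.push_e, Vec.coord_pull]

theorem extendEnd_mem {ι κ : Type} (f : ι ↪ κ) (A : sl ι) : extendEnd f A.mat ∈ slSub κ := by
  have h : slSub ι ≤ (slSub κ).comap (extendEnd f) := by
    refine Submodule.span_le.mpr ?_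
    rintro _ (⟨i, j, h, rfl⟩ | ⟨i, j, rfl⟩)
    · exact Submodule.subset_span (Or.inl ⟨_, _, f.injective.ne h, extendEnd_E f i j⟩)
    · refine Submodule.subset_span (Or.inr ⟨f i, f j, ?_⟩)
      rw [← extendEnd_E, ← extendEnd_E]
      exact map_sub (extendEnd f) _ _
  exact h A.2

/-- The inclusion `sl(ι) → sl(κ)` induced by an injection `ι ↪ κ`. -/
def slIncl {ι κ : Type} (f : ι ↪ κ) : sl ι →ₗ⁅ℂ⁆ sl κ where
  toFun A := ⟨extendEnd f A.mat, extendEnd_mem f A⟩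
  map_add' A B := sl.ext ((extendEnd f).map_add A.mat B.mat)
  map_smul' c A := sl.ext ((extendEnd f).map_smul c A.mat)
  map_lie' {A B} := by
    refine sl.ext ?_
    change extendEnd f (A.mat * B.mat - B.mat * A.mat) =
      extendEnd f A.mat * extendEnd f B.mat - extendEnd f B.mat * extendEnd f A.mat
    rw [map_sub, extendEnd_mul, extendEnd_mul]

/-- The `sl(∞)`-module `M`, regarded as a module over `sl(n) ⊆ sl(∞)` (the first `n` indices). -/
def Res (_n : ℕ) (M : Type) : Type := M

variable (n : ℕ) (M : Type) [AddCommGroup M] [Module ℂ M] [LieRingModule (sl ℕ) M]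
  [LieModule ℂ (sl ℕ) M]

instance : AddCommGroup (Res n M) := inferInstanceAs (AddCommGroup M)

instance : Module ℂ (Res n M) := inferInstanceAs (Module ℂ M)

instance : LieRingModule (sl (Fin n)) (Res n M) :=
  LieRingModule.compLieHom M (slIncl Fin.valEmbedding)

instance : LieModule ℂ (sl (Fin n)) (Res n M) :=
  LieModule.compLieHom M (slIncl Fin.valEmbedding)

/-- The restriction `≺_n` of an order on the positive integers to the first `n` of them. -/
def restrictOrder (r : ℕ → ℕ → Prop) (n : ℕ) (i j : Fin n) : Prop := r i j

/-- A simple weight `sl(∞)`-module `M` is pseudo `𝔭(≺)`-aligned if it is not `𝔭(≺)`-aligned, but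
is the direct limit (the increasing union) of `sl(n)`-submodules `M_n`, `n ≥ 1`, where `M_n` is a
simple `𝔭(≺_n)`-aligned `sl(n)`-module for every `n`. -/
def IsPseudoAligned (r : ℕ → ℕ → Prop) : Prop :=
  LieModule.IsIrreducible ℂ (sl ℕ) M ∧ IsWeightModule (cartan ℕ) M ∧ ¬ IsAligned r M ∧
    ∃ N : (n : ℕ) → LieSubmodule ℂ (sl (Fin n)) (Res n M),
      (∀ n, 1 ≤ n → ∀ m : M, m ∈ N n → m ∈ N (n + 1)) ∧
      (∀ m : M, ∃ n, 1 ≤ n ∧ m ∈ N n) ∧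
      ∀ n, 1 ≤ n → IsAligned (restrictOrder r n) (N n)

end Pseudo

/-! ### The modules `X(μ)` -/

section Xmod

variable {ι : Type}

/-- The space spanned by the formal monomials `x^λ = ∏ x_i ^ λ_i`, for `λ ∈ ℂ^ι`. -/
def Mono (ι : Type) : Type := (ι → ℂ) →₀ ℂ

instance : AddCommGroup (Mono ι) := inferInstanceAs (AddCommGroup ((ι → ℂ) →₀ ℂ))

instance : Module ℂ (Mono ι) := inferInstanceAs (Module ℂ ((ι → ℂ) →₀ ℂ))

/-- The monomial `x^λ`. -/
def mono (l : ι → ℂ) : Mono ι := Finsupp.single l (1 : ℂ)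

theorem Mono.hom_ext {f g : Module.End ℂ (Mono ι)} (h : ∀ l, f (mono l) = g (mono l)) : f = g :=
  Finsupp.lhom_ext' fun l => LinearMap.ext_ring (h l)

theorem gl_comm_mem {A B : Module.End ℂ (Vec ι)}
    (hA : A ∈ Submodule.span ℂ (Set.range (Efam ι)))
    (hB : B ∈ Submodule.span ℂ (Set.range (Efam ι))) :
    A * B - B * A ∈ Submodule.span ℂ (Set.range (Efam ι)) :=
  slGen_span_le ι (comm_mem' hA hB)

variable [DecidableEq ι]

/-- The vector `ε_i ∈ ℂ^ι`. -/
def eps (i : ι) : ι → ℂ := Pi.single i 1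

/-- The operator `x_i ∂_j`, given by `x^λ ↦ λ_j x^(λ + ε_i - ε_j)`. -/
def xd (i j : ι) : Module.End ℂ (Mono ι) :=
  Finsupp.linearCombination ℂ fun l : ι → ℂ => l j • mono (l + eps i - eps j)

theorem xd_mono (i j : ι) (l : ι → ℂ) : xd i j (mono l) = l j • mono (l + eps i - eps j) := by
  change Finsupp.linearCombination ℂ _ (Finsupp.single l (1 : ℂ)) = _
  rw [Finsupp.linearCombination_single, one_smul]

theorem xd_comm (i j k l : ι) :
    xd i j * xd k l - xd k l * xd i j = (if j = k then xd i l else 0) - (if l = i then xd k j else 0) := by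
  refine Mono.hom_ext fun a => ?_
  have e1 : a + eps k - eps l + eps i - eps j = a + eps i - eps j + eps k - eps l := by abel
  rw [LinearMap.sub_apply, Module.End.mul_apply, Module.End.mul_apply, xd_mono,
    xd_mono, map_smul, map_smul, xd_mono, xd_mono, e1, LinearMap.sub_apply, smul_smul, smul_smul,
    ← sub_smul]
  have e2 : j = k → a + eps i - eps j + eps k - eps l = a + eps i - eps l := by
    rintro rfl; abel
  have e3 : l = i → a + eps i - eps j + eps k - eps l = a + eps k - eps j := by
    rintro rfl; abel
  have c : a l * (a + eps k - eps l) j - a j * (a + eps i - eps j) l =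
      (if j = k then a l else 0) - (if l = i then a j else 0) := by
    simp only [Pi.sub_apply, Pi.add_apply, eps, Pi.single_apply]
    by_cases h1 : j = l
    · subst h1; split_ifs <;> ring
    · rw [if_neg h1, if_neg (Ne.symm h1)]; split_ifs <;> ring
  rw [c, sub_smul]
  congr 1
  · split_ifs with h
    · rw [xd_mono, e2 h]
    · rw [zero_smul, LinearMap.zero_apply]
  · split_ifs with h
    · rw [xd_mono, e3 h]
    · rw [zero_smul, LinearMap.zero_apply]

/-- The linear map `E_ij ↦ x_i ∂_j` on the span of the elementary matrices. -/
def glRep (ι : Type) [DecidableEq ι] :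
    Submodule.span ℂ (Set.range (Efam ι)) →ₗ[ℂ] Module.End ℂ (Mono ι) :=
  (Finsupp.linearCombination ℂ fun p : ι × ι => xd p.1 p.2) ∘ₗ (linearIndependent_Efam ι).repr

theorem glRep_E (i j : ι) (h : E i j ∈ Submodule.span ℂ (Set.range (Efam ι))) :
    glRep ι ⟨E i j, h⟩ = xd i j := by
  rw [glRep, LinearMap.comp_apply, (linearIndependent_Efam ι).repr_eq_single (i, j) _ rfl,
    Finsupp.linearCombination_single, one_smul]

theorem glRep_comm {A B : Module.End ℂ (Vec ι)}
    (hA : A ∈ Submodule.span ℂ (Set.range (Efam ι)))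
    (hB : B ∈ Submodule.span ℂ (Set.range (Efam ι))) :
    glRep ι ⟨A * B - B * A, gl_comm_mem hA hB⟩ =
      glRep ι ⟨A, hA⟩ * glRep ι ⟨B, hB⟩ - glRep ι ⟨B, hB⟩ * glRep ι ⟨A, hA⟩ := by
  refine Submodule.span_induction₂
    (p := fun A B hA hB => glRep ι ⟨A * B - B * A, gl_comm_mem hA hB⟩ =
      glRep ι ⟨A, hA⟩ * glRep ι ⟨B, hB⟩ - glRep ι ⟨B, hB⟩ * glRep ι ⟨A, hA⟩)
    ?_ ?_ ?_ ?_ ?_ ?_ ?_ hA hB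
  · rintro _ _ ⟨⟨i, j⟩, rfl⟩ ⟨⟨k, l⟩, rfl⟩
    have hE (a b : ι) : E a b ∈ Submodule.span ℂ (Set.range (Efam ι)) :=
      Submodule.subset_span (Set.mem_range_self (f := Efam ι) (a, b))
    have e : (⟨Efam ι (i, j) * Efam ι (k, l) - Efam ι (k, l) * Efam ι (i, j),
        gl_comm_mem (hE i j) (hE k l)⟩ : Submodule.span ℂ (Set.range (Efam ι))) =
        (if j = k then ⟨E i l, hE i l⟩ else 0) - (if l = i then ⟨E k j, hE k j⟩ else 0) := by
      refine Subtype.ext ?_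
      change E i j * E k l - E k l * E i j = _
      rw [E_comm]
      split_ifs <;> rfl
    rw [e, map_sub]
    change _ = glRep ι ⟨E i j, hE i j⟩ * glRep ι ⟨E k l, hE k l⟩ -
      glRep ι ⟨E k l, hE k l⟩ * glRep ι ⟨E i j, hE i j⟩
    rw [glRep_E, glRep_E, xd_comm]
    congr 1
    · split_ifs
      · rw [glRep_E]
      · rw [map_zero]
    · split_ifs
      · rw [glRep_E]
      · rw [map_zero]
  · intro y hy
    have e1 : (⟨0 * y - y * 0, gl_comm_mem (zero_mem _) hy⟩ :
        Submodule.span ℂ (Set.range (Efam ι))) = 0 := Subtype.ext (by simp)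
    have e2 : (⟨0, zero_mem _⟩ : Submodule.span ℂ (Set.range (Efam ι))) = 0 := rfl
    rw [e1, e2, map_zero, zero_mul, mul_zero, sub_zero]
  · intro y hy
    have e1 : (⟨y * 0 - 0 * y, gl_comm_mem hy (zero_mem _)⟩ :
        Submodule.span ℂ (Set.range (Efam ι))) = 0 := Subtype.ext (by simp)
    have e2 : (⟨0, zero_mem _⟩ : Submodule.span ℂ (Set.range (Efam ι))) = 0 := rfl
    rw [e1, e2, map_zero, zero_mul, mul_zero, sub_zero]
  · intro x y z hx hy hz h1 h2
    have e1 : (⟨(x + y) * z - z * (x + y), gl_comm_mem (add_mem hx hy) hz⟩ :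
        Submodule.span ℂ (Set.range (Efam ι))) =
        ⟨x * z - z * x, gl_comm_mem hx hz⟩ + ⟨y * z - z * y, gl_comm_mem hy hz⟩ :=
      Subtype.ext (by change _ = (x * z - z * x) + (y * z - z * y); noncomm_ring)
    have e2 : (⟨x + y, add_mem hx hy⟩ : Submodule.span ℂ (Set.range (Efam ι))) =
        ⟨x, hx⟩ + ⟨y, hy⟩ := rfl
    rw [e1, e2, map_add, map_add, h1, h2]
    noncomm_ring
  · intro x y z hx hy hz h1 h2
    have e1 : (⟨x * (y + z) - (y + z) * x, gl_comm_mem hx (add_mem hy hz)⟩ :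
        Submodule.span ℂ (Set.range (Efam ι))) =
        ⟨x * y - y * x, gl_comm_mem hx hy⟩ + ⟨x * z - z * x, gl_comm_mem hx hz⟩ :=
      Subtype.ext (by change _ = (x * y - y * x) + (x * z - z * x); noncomm_ring)
    have e2 : (⟨y + z, add_mem hy hz⟩ : Submodule.span ℂ (Set.range (Efam ι))) =
        ⟨y, hy⟩ + ⟨z, hz⟩ := rfl
    rw [e1, e2, map_add, map_add, h1, h2]
    noncomm_ring
  · intro r x y hx hy h
    have e1 : (⟨(r • x) * y - y * (r • x), gl_comm_mem (Submodule.smul_mem _ r hx) hy⟩ :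
        Submodule.span ℂ (Set.range (Efam ι))) = r • ⟨x * y - y * x, gl_comm_mem hx hy⟩ :=
      Subtype.ext (by
        change (r • x) * y - y * (r • x) = r • (x * y - y * x)
        rw [smul_mul_assoc, mul_smul_comm, smul_sub])
    have e2 : (⟨r • x, Submodule.smul_mem _ r hx⟩ : Submodule.span ℂ (Set.range (Efam ι))) =
        r • ⟨x, hx⟩ := rfl
    rw [e1, e2, map_smul, map_smul, h, smul_mul_assoc, mul_smul_comm, smul_sub]
  · intro r x y hx hy h
    have e1 : (⟨x * (r • y) - (r • y) * x, gl_comm_mem hx (Submodule.smul_mem _ r hy)⟩ :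
        Submodule.span ℂ (Set.range (Efam ι))) = r • ⟨x * y - y * x, gl_comm_mem hx hy⟩ :=
      Subtype.ext (by
        change x * (r • y) - (r • y) * x = r • (x * y - y * x)
        rw [smul_mul_assoc, mul_smul_comm, smul_sub])
    have e2 : (⟨r • y, Submodule.smul_mem _ r hy⟩ : Submodule.span ℂ (Set.range (Efam ι))) =
        r • ⟨y, hy⟩ := rfl
    rw [e1, e2, map_smul, map_smul, h, smul_mul_assoc, mul_smul_comm, smul_sub]

/-- The action of `sl(ι)` on monomials: the linear map with `E_ij ↦ x_i ∂_j` (and hence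
`E_ii - E_jj ↦ x_i ∂_i - x_j ∂_j`). -/
def slRep (A : sl ι) : Module.End ℂ (Mono ι) := glRep ι ⟨A.mat, slGen_span_le ι A.2⟩

theorem slRep_add (A B : sl ι) : slRep (A + B) = slRep A + slRep B :=
  (glRep ι).map_add ⟨A.mat, slGen_span_le ι A.2⟩ ⟨B.mat, slGen_span_le ι B.2⟩

theorem slRep_smul (c : ℂ) (A : sl ι) : slRep (c • A) = c • slRep A :=
  (glRep ι).map_smul c ⟨A.mat, slGen_span_le ι A.2⟩

theorem slRep_lie (A B : sl ι) : slRep ⁅A, B⁆ = slRep A * slRep B - slRep B * slRep A :=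
  glRep_comm (slGen_span_le ι A.2) (slGen_span_le ι B.2)

theorem slRep_rootVec (i j : ι) (h : i ≠ j) : slRep (rootVec i j h) = xd i j := glRep_E i j _

theorem slRep_coroot (i j : ι) : slRep (coroot i j) = xd i i - xd j j := by
  have h (k : ι) : E k k ∈ Submodule.span ℂ (Set.range (Efam ι)) :=
    Submodule.subset_span (Set.mem_range_self (f := Efam ι) (k, k))
  refine ((glRep ι).map_sub ⟨E i i, h i⟩ ⟨E j j, h j⟩).trans ?_
  rw [glRep_E, glRep_E]

instance : LieRingModule (sl ι) (Mono ι) where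
  bracket A m := slRep A m
  add_lie A B m := by
    change slRep (A + B) m = slRep A m + slRep B m
    rw [slRep_add, LinearMap.add_apply]
  lie_add A m m' := (slRep A).map_add m m'
  leibniz_lie A B m := by
    change slRep A (slRep B m) = slRep ⁅A, B⁆ m + slRep B (slRep A m)
    rw [slRep_lie, LinearMap.sub_apply, Module.End.mul_apply, Module.End.mul_apply,
      sub_add_cancel]

theorem lie_mono_def (A : sl ι) (m : Mono ι) : ⁅A, m⁆ = slRep A m := rfl

instance : LieModule ℂ (sl ι) (Mono ι) where
  smul_lie c A m := by rw [lie_mono_def, lie_mono_def, slRep_smul, LinearMap.smul_apply]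
  lie_smul c A m := (slRep A).map_smul c m

/-- The root lattice `Q`, as a subgroup of `ℂ^ι`: the `ℤ`-span of the vectors `ε_i - ε_j`. -/
def rootLattice (ι : Type) [DecidableEq ι] : AddSubgroup (ι → ℂ) :=
  AddSubgroup.closure {v | ∃ i j : ι, i ≠ j ∧ v = eps i - eps j}

/-- `Int(μ)`: the set of `i` such that `μ_i` is an integer. -/
def intAll (m : ι → ℂ) : Set ι := {i | ∃ k : ℤ, m i = k}

/-- `Int⁺(μ)`: the set of `i` such that `μ_i` is a nonnegative integer. -/
def intPlus (m : ι → ℂ) : Set ι := {i | ∃ k : ℤ, 0 ≤ k ∧ m i = k}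

/-- `Int⁻(μ)`: the set of `i` such that `μ_i` is a negative integer. -/
def intMinus (m : ι → ℂ) : Set ι := {i | ∃ k : ℤ, k < 0 ∧ m i = k}

/-- The exponents of the monomials spanning `V(μ)`. -/
def vExp (m : ι → ℂ) : Set (ι → ℂ) := {l | l - m ∈ rootLattice ι ∧ intPlus m ⊆ intPlus l}

theorem eps_sub_mem (i j : ι) : eps i - eps j ∈ rootLattice ι := by
  by_cases h : i = j
  · subst h; rw [sub_self]; exact zero_mem _
  · exact AddSubgroup.subset_closure ⟨i, j, h, rfl⟩

theorem xd_mem (m : ι → ℂ) (i j : ι) {x : Mono ι} (hx : x ∈ Submodule.span ℂ (mono '' vExp m)) :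
    xd i j x ∈ Submodule.span ℂ (mono '' vExp m) := by
  have h : Submodule.span ℂ (mono '' vExp m) ≤
      (Submodule.span ℂ (mono '' vExp m)).comap (xd i j) := by
    refine Submodule.span_le.mpr ?_
    rintro _ ⟨l, ⟨hl1, hl2⟩, rfl⟩
    change xd i j (mono l) ∈ Submodule.span ℂ (mono '' vExp m)
    rw [xd_mono]
    by_cases h0 : l j = 0
    · rw [h0, zero_smul]; exact zero_mem _
    refine Submodule.smul_mem _ _ (Submodule.subset_span ⟨_, ⟨?_, ?_⟩, rfl⟩)
    · have e : l + eps i - eps j - m = (l - m) + (eps i - eps j) := by abel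
      rw [e]; exact add_mem hl1 (eps_sub_mem i j)
    · intro k hk
      obtain ⟨a, ha, hak⟩ := hl2 hk
      by_cases hki : k = i
      · by_cases hkj : k = j
        · exact ⟨a, ha, by subst hki; subst hkj; simp [hak]⟩
        · subst hki
          exact ⟨a + 1, by omega, by simp [eps, hak, hkj]⟩
      · by_cases hkj : k = j
        · subst hkj
          have : a ≠ 0 := by rintro rfl; exact h0 (by simpa using hak)
          exact ⟨a - 1, by omega, by simp [eps, hak, hki]⟩
        · exact ⟨a, ha, by simp [eps, hak, hki, hkj]⟩
  exact h hx

theorem slRep_mem (m : ι → ℂ) (A : sl ι) {x : Mono ι}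
    (hx : x ∈ Submodule.span ℂ (mono '' vExp m)) :
    slRep A x ∈ Submodule.span ℂ (mono '' vExp m) := by
  rw [slRep, glRep, LinearMap.comp_apply, Finsupp.linearCombination_apply, Finsupp.sum,
    LinearMap.sum_apply]
  exact Submodule.sum_mem _ fun p _ => Submodule.smul_mem _ _ (xd_mem m p.1 p.2 hx)

/-- The submodule `V(μ)`, spanned by the `x^λ` with `λ - μ ∈ Q` and `Int⁺(μ) ⊆ Int⁺(λ)`. -/
def V (m : ι → ℂ) : LieSubmodule ℂ (sl ι) (Mono ι) where
  __ := Submodule.span ℂ (mono '' vExp m)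
  lie_mem hx := slRep_mem m _ hx

/-- The submodule `V(μ)⁺`: the sum of all `V(μ')` with `μ' - μ ∈ Q` and `Int⁺(μ) ⊊ Int⁺(μ')`
(equivalently, of all `V(μ')` properly contained in `V(μ)`). It is zero if `Int⁻(μ)` is empty, as
there are no such `μ'` then. -/
def Vplus (m : ι → ℂ) : LieSubmodule ℂ (sl ι) (Mono ι) :=
  ⨆ m' ∈ {m' : ι → ℂ | m' - m ∈ rootLattice ι ∧ intPlus m ⊂ intPlus m'}, V m'

/-- The module `X(μ) = V(μ) / V(μ)⁺`. -/
def X (m : ι → ℂ) : Type := V m ⧸ (Vplus m).comap (V m).incl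

instance (m : ι → ℂ) : AddCommGroup (X m) :=
  inferInstanceAs (AddCommGroup (V m ⧸ (Vplus m).comap (V m).incl))

instance (m : ι → ℂ) : Module ℂ (X m) :=
  inferInstanceAs (Module ℂ (V m ⧸ (Vplus m).comap (V m).incl))

instance (m : ι → ℂ) : LieRingModule (sl ι) (X m) :=
  inferInstanceAs (LieRingModule (sl ι) (V m ⧸ (Vplus m).comap (V m).incl))

instance (m : ι → ℂ) : LieModule ℂ (sl ι) (X m) :=
  inferInstanceAs (LieModule ℂ (sl ι) (V m ⧸ (Vplus m).comap (V m).incl))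

end Xmod

/-! ### The order given by the shadow of a module, and compatibility of orders -/

section Compat

variable {ι : Type}

/-- The order `≺_M` of the parabolic subalgebra `𝔭_M` attached to the shadow of `M`: one has
`i ≺_M j` if the root `ε_i - ε_j` lies in `Δ_M⁺`, that is, if for the weights `χ` of `M` the set of
all real `q` such that `χ + q (ε_i - ε_j)` is a weight of `M` is bounded from above but not from
below. -/
def shadowOrder (M : Type) [AddCommGroup M] [Module ℂ M] [LieRingModule (sl ι) M]
    [LieModule ℂ (sl ι) M] (i j : ι) : Prop :=
  i ≠ j ∧ ∀ χ ∈ support (cartan ι) M,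
    BddAbove {q : ℝ | χ + (q : ℂ) • root i j ∈ support (cartan ι) M} ∧
      ¬ BddBelow {q : ℝ | χ + (q : ℂ) • root i j ∈ support (cartan ι) M}

/-- `A` weakly precedes `B`: for `a ∈ A` and `b ∈ B`, either `a ≺ b` or `[a] = [b]`. -/
def WeaklyPrecedes (r : ι → ι → Prop) (A B : Set ι) : Prop :=
  ∀ a ∈ A, ∀ b ∈ B, r a b ∨ cls r a = cls r b

/-- The order `≺` is `sl`-compatible with `μ`: it coincides with `≺_μ` on the complement `I` of
`Int(μ)`, and `Int⁻(μ)`, `I`, `Int⁺(μ)` weakly precede each other in this order. -/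
def SlCompatible [DecidableEq ι] (r : ι → ι → Prop) (m : ι → ℂ) : Prop :=
  (∀ i ∈ (intAll m)ᶜ, ∀ j ∈ (intAll m)ᶜ, (r i j ↔ shadowOrder (X m) i j)) ∧
    WeaklyPrecedes r (intMinus m) (intAll m)ᶜ ∧
    WeaklyPrecedes r (intAll m)ᶜ (intPlus m) ∧
    WeaklyPrecedes r (intMinus m) (intPlus m)

/-- The truncation `μ^n = (μ_1, …, μ_n)`. -/
def truncate (m : ℕ → ℂ) (n : ℕ) (i : Fin n) : ℂ := m i

/-- The order `≺` is locally `sl`-compatible with `μ`: for every `n ≥ 1`, its restriction `≺_n` is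
`sl`-compatible with `μ^n`. -/
def LocallySlCompatible (r : ℕ → ℕ → Prop) (m : ℕ → ℂ) : Prop :=
  ∀ n, 1 ≤ n → SlCompatible (restrictOrder r n) (truncate m n)

end Compat

end SlModules

end

noncomputable section

namespace SlModules

/-! ### The root lattice -/

section Lattice

variable {ι : Type} [DecidableEq ι]

/-! The module X(μ) has a basis of monomials x^λ, where λ runs over μ + Q with Int⁺(λ) = Int⁺(μ)
(`xBasis`). Distinct basis monomials have distinct weights (`chi_injOn`), so every 𝔥-stable subspace
is spanned by monomials. In X(μ) the vector E_ij x^λ = λ_j x^(λ+ε_i-ε_j) vanishes exactly when λ_j =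
0 or λ_i = -1: in the second case the new exponent leaves the basis. Call λ invariant if one of
these equations holds for every pair i ≺ j (`invExp`).

If X(μ) is aligned, the image of some 1 ⊗ s is a nonzero vector killed by 𝔲(≺)
(`IsAligned.exists_killed`), and any monomial occurring in it has an invariant exponent
(`exists_exp_of_killed`). Conversely, the invariant monomials span a 𝔭(≺)-submodule which is simple
over 𝔩(≺), because any two of them are joined by steps along 𝔩(≺)-roots with nonzero coefficients
(`xb_mem_of_levi_stable`). Its inclusion extends to the induced module, and the extension is onto
because X(μ) is simple (`isAligned_X`). Thus alignedness amounts to the existence of an invariant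
exponent.

An invariant exponent forces compatibility: i ≺ j is possible only if j ∈ Int⁺ or i ∈ Int⁻
(`slCompatible_of_exp`). On a finite index set the converse is an optimisation argument. A
compatible order has an integer height c which strictly decreases along ≺ and is ≥ 0 on Int⁻, 0 on
I, ≤ 0 on Int⁺. Then ∑ c_i (λ_i - μ_i) is bounded above on the exponents, and a maximiser is
invariant, since an available step ε_i - ε_j with i ≺ j would increase it
(`SlCompatible.invExp_nonempty`).

For sl(∞), X(μ) is the increasing union of copies of X(μ^n), spanned by the monomials that agree
with μ from index n on; this gives pseudo-alignedness from local compatibility. In the other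
direction, a vector killed by 𝔲(≺_n) in any aligned sl(n)-submodule of X(μ) yields an exponent whose
first n entries witness compatibility with μ^n (`slCompatible_of_isAligned_res`). -/

theorem eps_sub_apply (i j k : ι) :
    (eps i - eps j) k = (((if k = i then 1 else 0) - (if k = j then 1 else 0) : ℤ) : ℂ) := by
  simp only [eps, Pi.sub_apply, Pi.single_apply]
  push_cast
  rfl

theorem mem_rootLattice_iff {v : ι → ℂ} :
    v ∈ rootLattice ι ↔ ∃ f : ι →₀ ℤ, (f.sum fun _ k => k) = 0 ∧ ∀ i, v i = f i := by
  constructor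
  · intro hv
    refine AddSubgroup.closure_induction
      (p := fun (v : ι → ℂ) _ => ∃ f : ι →₀ ℤ, (f.sum fun _ k => k) = 0 ∧ ∀ i, v i = f i) ?_ ?_ ?_ ?_ hv
    · rintro _ ⟨i, j, -, rfl⟩
      refine ⟨Finsupp.single i 1 - Finsupp.single j 1, ?_, fun k => ?_⟩
      · rw [Finsupp.sum_sub_index (fun _ _ _ => rfl), Finsupp.sum_single_index rfl,
          Finsupp.sum_single_index rfl, sub_self]
      · rw [eps_sub_apply, Finsupp.sub_apply, Finsupp.single_apply, Finsupp.single_apply]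
        simp only [eq_comm]
    · exact ⟨0, Finsupp.sum_zero_index, fun i => by simp⟩
    · rintro x y - - ⟨f, hf, hx⟩ ⟨g, hg, hy⟩
      refine ⟨f + g, ?_, fun i => ?_⟩
      · rw [Finsupp.sum_add_index' (fun _ => rfl) (fun _ _ _ => rfl), hf, hg, add_zero]
      · rw [Pi.add_apply, hx, hy, Finsupp.add_apply, Int.cast_add]
    · rintro x - ⟨f, hf, hx⟩
      refine ⟨-f, ?_, fun i => ?_⟩
      · rw [Finsupp.sum_neg_index (fun _ => rfl), Finsupp.sum, Finset.sum_neg_distrib]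
        exact neg_eq_zero.mpr hf
      · rw [Pi.neg_apply, hx, Finsupp.neg_apply, Int.cast_neg]
  · rintro ⟨f, hf, hv⟩
    rcases isEmpty_or_nonempty ι with h | ⟨⟨i₀⟩⟩
    · rw [Subsingleton.elim v 0]; exact zero_mem _
    -- Any base point i₀ will do: the terms in ε_{i₀} cancel because the coefficients sum to zero.
    have e : v = ∑ i ∈ f.support, f i • (eps i - eps i₀) := by
      funext k
      simp only [smul_sub, Finset.sum_sub_distrib, ← Finset.sum_smul]
      have : ∑ i ∈ f.support, f i = 0 := hf
      rw [this, zero_smul, sub_zero, Finset.sum_apply, hv]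
      simp [eps, Pi.single_apply]
    rw [e]
    exact sum_mem fun i _ => zsmul_mem (eps_sub_mem i i₀) _

/-- A nonzero constant c would give the coordinate sum c times the size of the finite support, which
cannot be zero. This is what makes weights separate monomials. -/
theorem eq_zero_of_mem_rootLattice_of_const {v : ι → ℂ} (hv : v ∈ rootLattice ι)
    (h : ∀ i j, v i = v j) : v = 0 := by
  obtain ⟨f, hf, hvf⟩ := mem_rootLattice_iff.mp hv
  funext k
  by_contra hk
  have hfk : f k ≠ 0 := fun h0 => hk (by rw [hvf, h0]; simp)
  have hc : ∀ i, f i = f k := fun i => by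
    have := h i k
    rw [hvf, hvf] at this
    exact_mod_cast this
  rw [Finsupp.sum, Finset.sum_congr rfl fun i _ => hc i, Finset.sum_const, smul_eq_zero] at hf
  rcases hf with h0 | h0
  · rw [Finset.card_eq_zero, Finsupp.support_eq_empty] at h0
    exact hfk (by rw [h0]; rfl)
  · exact hfk h0

end Lattice

/-! ### The monomial basis of `X(μ)` -/

section Exponents

variable {ι : Type}

theorem intMinus_eq (m : ι → ℂ) : intMinus m = intAll m \ intPlus m := by
  ext i
  constructor
  · rintro ⟨k, hk, h⟩
    refine ⟨⟨k, h⟩, ?_⟩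
    rintro ⟨k', hk', h'⟩
    have : k = k' := by exact_mod_cast h.symm.trans h'
    omega
  · rintro ⟨⟨k, h⟩, h'⟩
    exact ⟨k, by by_contra hk; exact h' ⟨k, by omega, h⟩, h⟩

theorem intPlus_subset_intAll (m : ι → ℂ) : intPlus m ⊆ intAll m := fun _ ⟨k, _, h⟩ => ⟨k, h⟩

theorem mem_span_mono {s : Set (ι → ℂ)} {x : Mono ι} :
    x ∈ Submodule.span ℂ (mono '' s) ↔ ∀ l, (show (ι → ℂ) →₀ ℂ from x) l ≠ 0 → l ∈ s := by
  have h : x ∈ Submodule.span ℂ (mono '' s) ↔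
      (show (ι → ℂ) →₀ ℂ from x) ∈ Finsupp.supported ℂ ℂ s :=
    Iff.of_eq (congrArg (fun p => (show (ι → ℂ) →₀ ℂ from x) ∈ p)
      (Finsupp.supported_eq_span_single ℂ s).symm)
  exact h.trans ((Finsupp.mem_supported _ _).trans
    (forall_congr' fun l => imp_congr_left Finsupp.mem_support_iff))

end Exponents

section Basis

variable {ι : Type} [DecidableEq ι]

/-- The exponents of the monomials that form a basis of `X(μ)`. -/
def xExp (m : ι → ℂ) : Set (ι → ℂ) := {l | l - m ∈ rootLattice ι ∧ intPlus l = intPlus m}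

theorem self_mem_xExp (m : ι → ℂ) : m ∈ xExp m := ⟨by rw [sub_self]; exact zero_mem _, rfl⟩

theorem xExp_subset_vExp (m : ι → ℂ) : xExp m ⊆ vExp m := fun _ h => ⟨h.1, h.2.symm.subset⟩

theorem intAll_eq_of_sub_mem {l m : ι → ℂ} (h : l - m ∈ rootLattice ι) : intAll l = intAll m := by
  obtain ⟨f, -, hf⟩ := mem_rootLattice_iff.mp h
  have hf' : ∀ i, l i = m i + f i := fun i => by rw [← hf, Pi.sub_apply, add_sub_cancel]
  ext i
  constructor
  · rintro ⟨k, hk⟩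
    exact ⟨k - f i, by push_cast; rw [← hk, hf', add_sub_cancel_right]⟩
  · rintro ⟨k, hk⟩
    exact ⟨k + f i, by push_cast; rw [← hk, hf']⟩

theorem intMinus_eq_of_mem_xExp {l m : ι → ℂ} (h : l ∈ xExp m) : intMinus l = intMinus m := by
  rw [intMinus_eq, intMinus_eq, intAll_eq_of_sub_mem h.1, h.2]

/-- The exponents of the monomials spanning `V(μ)⁺`. -/
def vplusExp (m : ι → ℂ) : Set (ι → ℂ) := {l | l - m ∈ rootLattice ι ∧ intPlus m ⊂ intPlus l}

/-- Each summand is spanned by monomials, and a monomial x^λ with λ in `vplusExp m` already lies in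
its own V(λ), which is one of the summands. -/
theorem vplus_toSubmodule (m : ι → ℂ) :
    (Vplus m).toSubmodule = Submodule.span ℂ (mono '' vplusExp m) := by
  rw [Vplus]
  simp only [LieSubmodule.iSup_toSubmodule]
  apply le_antisymm
  · refine iSup₂_le fun m' hm' => Submodule.span_mono (Set.image_mono fun l hl => ⟨?_, ?_⟩)
    · have e : l - m = (l - m') + (m' - m) := by abel
      rw [e]; exact add_mem hl.1 hm'.1
    · exact hm'.2.trans_subset hl.2
  · refine Submodule.span_le.mpr ?_
    rintro _ ⟨l, hl, rfl⟩
    have h1 : (V l).toSubmodule ≤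
        ⨆ m' ∈ {m' : ι → ℂ | m' - m ∈ rootLattice ι ∧ intPlus m ⊂ intPlus m'},
          (V m').toSubmodule := le_iSup₂ (f := fun m' (_ : m' ∈ {m' : ι → ℂ |
            m' - m ∈ rootLattice ι ∧ intPlus m ⊂ intPlus m'}) => (V m').toSubmodule) l hl
    exact h1 (Submodule.subset_span ⟨l, xExp_subset_vExp l (self_mem_xExp l), rfl⟩)

/-- Projection from `V(μ)` to the span of the basis monomials of `X(μ)`. -/
def vProj (m : ι → ℂ) : V m →ₗ[ℂ] (xExp m →₀ ℂ) :=
  Finsupp.lsubtypeDomain (xExp m) ∘ₗ (V m).toSubmodule.subtype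

theorem mem_vExp_iff {l m : ι → ℂ} : l ∈ vExp m ↔ l ∈ xExp m ∨ l ∈ vplusExp m := by
  constructor
  · rintro ⟨h1, h2⟩
    rcases h2.eq_or_ssubset with h | h
    · exact Or.inl ⟨h1, h.symm⟩
    · exact Or.inr ⟨h1, h⟩
  · rintro (h | h)
    · exact xExp_subset_vExp m h
    · exact ⟨h.1, h.2.subset⟩

theorem notMem_vplusExp_of_mem_xExp {l m : ι → ℂ} (h : l ∈ xExp m) : l ∉ vplusExp m :=
  fun h' => h'.2.ne h.2.symm

theorem vProj_mono_of_mem {l m : ι → ℂ} (h : l ∈ xExp m) (h' : mono l ∈ V m) :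
    vProj m ⟨mono l, h'⟩ = Finsupp.single ⟨l, h⟩ 1 := by
  refine Finsupp.ext fun k => ?_
  change (Finsupp.single l (1 : ℂ)) k.1 = _
  classical
  rw [Finsupp.single_apply, Finsupp.single_apply]
  simp only [Subtype.ext_iff]

theorem mono_mem_V {l m : ι → ℂ} (h : l ∈ vExp m) : mono l ∈ V m :=
  Submodule.subset_span ⟨l, h, rfl⟩

theorem vProj_surjective (m : ι → ℂ) : Function.Surjective (vProj m) := by
  rw [← LinearMap.range_eq_top, eq_top_iff]
  intro f _
  rw [← Finsupp.sum_single f]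
  refine Submodule.sum_mem _ fun l _ => ?_
  rw [← mul_one (f l), ← smul_eq_mul, ← Finsupp.smul_single]
  refine Submodule.smul_mem _ _ ⟨⟨mono l.1, mono_mem_V (xExp_subset_vExp m l.2)⟩, ?_⟩
  exact vProj_mono_of_mem l.2 _

/-- The exponents of V(μ) split disjointly into `xExp m` and `vplusExp m`, so losing all coordinates
of the first kind means lying in V(μ)⁺. Hence X(μ) is the coordinate space on `xExp m`. -/
theorem ker_vProj (m : ι → ℂ) :
    LinearMap.ker (vProj m) = ((Vplus m).comap (V m).incl).toSubmodule := by
  ext v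
  change vProj m v = 0 ↔ v.1 ∈ (Vplus m).toSubmodule
  have hv := mem_span_mono.mp (show v.1 ∈ Submodule.span ℂ (mono '' vExp m) from v.2)
  rw [vplus_toSubmodule, mem_span_mono]
  constructor
  · intro h l hl
    exact (mem_vExp_iff.mp (hv l hl)).resolve_left fun hx => hl (DFunLike.congr_fun h ⟨l, hx⟩)
  · intro h
    refine Finsupp.ext fun l => ?_
    by_contra hl
    exact notMem_vplusExp_of_mem_xExp l.2 (h l.1 hl)

/-- The monomial basis of `X(μ)`. -/
def xBasis (m : ι → ℂ) : Module.Basis (xExp m) ℂ (X m) :=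
  .ofRepr ((Submodule.quotEquivOfEq _ _ (ker_vProj m).symm).trans
    ((vProj m).quotKerEquivOfSurjective (vProj_surjective m)))

/-- The projection `V(μ) → X(μ)`. -/
def xMk (m : ι → ℂ) : V m →ₗ⁅ℂ, sl ι⁆ X m :=
  LieSubmodule.Quotient.mk' ((Vplus m).comap (V m).incl)

theorem xBasis_repr_xMk (m : ι → ℂ) (v : V m) : (xBasis m).repr (xMk m v) = vProj m v := rfl

theorem xMk_mono_of_mem {l m : ι → ℂ} (h : l ∈ xExp m) (h' : mono l ∈ V m) :
    xMk m ⟨mono l, h'⟩ = xBasis m ⟨l, h⟩ := by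
  apply (xBasis m).repr.injective
  rw [xBasis_repr_xMk, vProj_mono_of_mem h, Module.Basis.repr_self]

theorem xMk_mono_of_notMem {l m : ι → ℂ} (h : l ∉ xExp m) (h' : mono l ∈ V m) :
    xMk m ⟨mono l, h'⟩ = 0 := by
  apply (xBasis m).repr.injective
  rw [xBasis_repr_xMk, map_zero]
  refine Finsupp.ext fun k => ?_
  change (Finsupp.single l (1 : ℂ)) k.1 = 0
  exact Finsupp.single_eq_of_ne fun e => h (e ▸ k.2)

open Classical in
/-- The class of `x^λ` in `X(μ)` if it belongs to the basis, and zero otherwise. -/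
def xb (m l : ι → ℂ) : X m := if h : l ∈ xExp m then xBasis m ⟨l, h⟩ else 0

theorem xb_of_mem {m l : ι → ℂ} (h : l ∈ xExp m) : xb m l = xBasis m ⟨l, h⟩ := dif_pos h

theorem xb_of_notMem {m l : ι → ℂ} (h : l ∉ xExp m) : xb m l = 0 := dif_neg h

theorem xMk_mono {l m : ι → ℂ} (h' : mono l ∈ V m) : xMk m ⟨mono l, h'⟩ = xb m l := by
  by_cases h : l ∈ xExp m
  · rw [xb_of_mem h, xMk_mono_of_mem h]
  · rw [xb_of_notMem h, xMk_mono_of_notMem h]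

theorem xb_coe (m : ι → ℂ) (l : xExp m) : xb m l = xBasis m l := xb_of_mem l.2

/-- The value zero of `xb` off the basis lets one formula cover both the vanishing of the
coefficient and the passage into V(μ)⁺. -/
theorem rootVec_lie_xb {m l : ι → ℂ} (hl : l ∈ xExp m) (i j : ι) (h : i ≠ j) :
    ⁅rootVec i j h, xb m l⁆ = l j • xb m (l + eps i - eps j) := by
  have hV := mono_mem_V (xExp_subset_vExp m hl)
  rw [← xMk_mono hV, ← LieModuleHom.map_lie]
  have e : (⁅rootVec i j h, (⟨mono l, hV⟩ : V m)⁆ : V m).1 = l j • mono (l + eps i - eps j) := by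
    change slRep (rootVec i j h) (mono l) = _
    rw [slRep_rootVec, xd_mono]
  -- When λ_j = 0 the shifted monomial need not lie in V(μ); otherwise dividing by λ_j shows that it
  -- does.
  by_cases h0 : l j = 0
  · have : ⁅rootVec i j h, (⟨mono l, hV⟩ : V m)⁆ = 0 := Subtype.ext (by rw [e, h0, zero_smul]; rfl)
    rw [this, h0, zero_smul, map_zero]
  · have hV' : mono (l + eps i - eps j) ∈ V m := by
      have := (V m).smul_mem (l j)⁻¹ (⁅rootVec i j h, (⟨mono l, hV⟩ : V m)⁆).2
      rwa [e, smul_smul, inv_mul_cancel₀ h0, one_smul] at this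
    have : ⁅rootVec i j h, (⟨mono l, hV⟩ : V m)⁆ = l j • ⟨mono (l + eps i - eps j), hV'⟩ :=
      Subtype.ext e
    rw [this, map_smul, xMk_mono]

theorem coroot_lie_xb {m l : ι → ℂ} (hl : l ∈ xExp m) (i j : ι) :
    ⁅coroot i j, xb m l⁆ = (l i - l j) • xb m l := by
  have hV := mono_mem_V (xExp_subset_vExp m hl)
  rw [← xMk_mono hV, ← LieModuleHom.map_lie, ← map_smul]
  congr 1
  refine Subtype.ext ?_
  change slRep (coroot i j) (mono l) = (l i - l j) • mono l
  rw [slRep_coroot, LinearMap.sub_apply, xd_mono, xd_mono, add_sub_cancel_right,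
    add_sub_cancel_right, sub_smul]

end Basis

/-! ### Weights of the monomials -/

section Weights

variable {ι : Type}

theorem coroot_mem_cartan (i j : ι) : coroot i j ∈ cartan ι :=
  Submodule.subset_span ⟨i, j, rfl⟩

theorem cartan_dual_ext {f g : Module.Dual ℂ (cartan ι)}
    (h : ∀ i j, f ⟨coroot i j, coroot_mem_cartan i j⟩ = g ⟨coroot i j, coroot_mem_cartan i j⟩) :
    f = g := by
  refine LinearMap.ext ?_
  rintro ⟨x, hx⟩
  refine Submodule.span_induction (p := fun x hx => f ⟨x, hx⟩ = g ⟨x, hx⟩) ?_ ?_ ?_ ?_ hx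
  · rintro _ ⟨i, j, rfl⟩; exact h i j
  · exact (map_zero f).trans (map_zero g).symm
  · intro a b ha hb h1 h2
    exact (map_add f ⟨a, ha⟩ ⟨b, hb⟩).trans
      ((congrArg₂ (· + ·) h1 h2).trans (map_add g ⟨a, ha⟩ ⟨b, hb⟩).symm)
  · intro c a ha h1
    exact (map_smul f c ⟨a, ha⟩).trans
      ((congrArg (c • ·) h1).trans (map_smul g c ⟨a, ha⟩).symm)

variable [DecidableEq ι]

/-- The weight of `x^λ`, as a functional on the Cartan subalgebra. -/
def chi (l : ι → ℂ) : Module.Dual ℂ (cartan ι) :=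
  Finsupp.linearCombination ℂ (fun p : ι × ι => if p.1 = p.2 then l p.1 else 0) ∘ₗ
    (linearIndependent_Efam ι).repr ∘ₗ Submodule.inclusion (slGen_span_le ι) ∘ₗ
      (show cartan ι →ₗ[ℂ] Submodule.span ℂ (slGen ι) from (cartan ι).subtype)

theorem chi_coroot (l : ι → ℂ) (i j : ι) :
    chi l ⟨coroot i j, coroot_mem_cartan i j⟩ = l i - l j := by
  have h (k : ι) : E k k ∈ Submodule.span ℂ (Set.range (Efam ι)) :=
    Submodule.subset_span (Set.mem_range_self (f := Efam ι) (k, k))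
  have h1 : (linearIndependent_Efam ι).repr (⟨E i i, h i⟩ - ⟨E j j, h j⟩) =
      Finsupp.single (i, i) 1 - Finsupp.single (j, j) 1 := by
    rw [map_sub, (linearIndependent_Efam ι).repr_eq_single (i, i) _ rfl,
      (linearIndependent_Efam ι).repr_eq_single (j, j) _ rfl]
  change Finsupp.linearCombination ℂ _ ((linearIndependent_Efam ι).repr
    (⟨E i i, h i⟩ - ⟨E j j, h j⟩)) = _
  rw [h1, map_sub, Finsupp.linearCombination_single, Finsupp.linearCombination_single]
  simp

theorem root_coroot (i j a b : ι) :
    root i j ⟨coroot a b, coroot_mem_cartan a b⟩ =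
      (eps i - eps j : ι → ℂ) a - (eps i - eps j : ι → ℂ) b := by
  have h (k a : ι) : matEntry k k (E a a) = (eps k : ι → ℂ) a := by
    by_cases e : a = k
    · subst e; rw [matEntry_E_same]; simp [eps]
    · have := matEntry_E_ne (p := (k, k)) (q := (a, a)) (by simpa using Ne.symm e)
      rw [show (0 : ℂ) = (eps k : ι → ℂ) a by simp [eps, e]] at this
      exact this
  change matEntry i i (E a a - E b b) - matEntry j j (E a a - E b b) = _
  rw [map_sub, map_sub, h, h, h, h, Pi.sub_apply, Pi.sub_apply]
  ring

theorem chi_add_smul_root (l : ι → ℂ) (i j : ι) (c : ℂ) :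
    chi (l + c • (eps i - eps j)) = chi l + c • root i j := by
  refine cartan_dual_ext fun a b => ?_
  rw [LinearMap.add_apply, LinearMap.smul_apply, chi_coroot, chi_coroot, root_coroot, smul_eq_mul,
    Pi.add_apply, Pi.add_apply, Pi.smul_apply, Pi.smul_apply, smul_eq_mul, smul_eq_mul]
  ring

/-- Coroots see only the differences of entries, so equal weights mean that the exponents differ by
a constant vector, and the only constant vector in the root lattice is zero. -/
theorem chi_injOn (m : ι → ℂ) : Set.InjOn chi (xExp m) := by
  intro l hl l' hl' h
  rw [← sub_eq_zero]
  refine eq_zero_of_mem_rootLattice_of_const ?_ fun i j => ?_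
  · have e : l - l' = (l - m) - (l' - m) := by abel
    rw [e]; exact sub_mem hl.1 hl'.1
  · have := LinearMap.congr_fun h ⟨coroot i j, coroot_mem_cartan i j⟩
    rw [chi_coroot, chi_coroot] at this
    rw [Pi.sub_apply, Pi.sub_apply]
    linear_combination this

theorem cartan_lie_xb {m l : ι → ℂ} (hl : l ∈ xExp m) (h : cartan ι) :
    ⁅(h : sl ι), xb m l⁆ = chi l h • xb m l := by
  obtain ⟨x, hx⟩ := h
  refine Submodule.span_induction (p := fun x hx => ⁅x, xb m l⁆ = chi l ⟨x, hx⟩ • xb m l)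
    ?_ ?_ ?_ ?_ hx
  · rintro _ ⟨i, j, rfl⟩
    exact (coroot_lie_xb hl i j).trans (by rw [chi_coroot])
  · rw [zero_lie]; exact (by rw [map_zero, zero_smul] : (0 : X m) = chi l 0 • xb m l)
  · intro a b ha hb h1 h2
    rw [add_lie, h1, h2, ← add_smul, ← map_add]; rfl
  · intro c a ha h1
    rw [smul_lie, h1, smul_smul, ← smul_eq_mul, ← map_smul]; rfl

theorem xb_mem_weightSpace {m l : ι → ℂ} (hl : l ∈ xExp m) :
    xb m l ∈ weightSpace (cartan ι) (X m) (chi l) := fun h => cartan_lie_xb hl h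

theorem xb_ne_zero {m l : ι → ℂ} (hl : l ∈ xExp m) : xb m l ≠ 0 := by
  rw [xb_of_mem hl]; exact (xBasis m).ne_zero _

theorem chi_mem_support {m l : ι → ℂ} (hl : l ∈ xExp m) :
    chi l ∈ support (cartan ι) (X m) := fun h => xb_ne_zero hl (by
  have := xb_mem_weightSpace hl
  rwa [h, Submodule.mem_bot] at this)

theorem repr_of_diagonal {D M : Type} [AddCommGroup M] [Module ℂ M] (b : Module.Basis D ℂ M)
    (T : M →ₗ[ℂ] M) (c : D → ℂ) (h : ∀ d, T (b d) = c d • b d) (v : M) (d : D) :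
    b.repr (T v) d = c d * b.repr v d := by
  have hT : (Finsupp.lapply d ∘ₗ b.repr.toLinearMap) ∘ₗ T =
      c d • (Finsupp.lapply d ∘ₗ b.repr.toLinearMap) := by
    refine b.ext fun d' => ?_
    rw [LinearMap.comp_apply, h, map_smul, LinearMap.smul_apply]
    by_cases hdd : d' = d
    · rw [hdd]
    · have : (Finsupp.lapply d ∘ₗ b.repr.toLinearMap) (b d') = 0 := by simp [hdd]
      rw [this, smul_zero, smul_zero]
  exact LinearMap.congr_fun hT v

/-- A module with a basis of weight vectors with pairwise different weights is a weight module. -/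
theorem isWeightModule_of_basis {L : Type} [LieRing L] [LieAlgebra ℂ L] (H : Submodule ℂ L)
    {M : Type} [AddCommGroup M] [Module ℂ M] [LieRingModule L M] [LieModule ℂ L M] {D : Type}
    (b : Module.Basis D ℂ M) (χ : D → Module.Dual ℂ H) (hχ : Function.Injective χ)
    (h : ∀ d, b d ∈ weightSpace H M (χ d)) : IsWeightModule H M := by
  constructor
  · rw [eq_top_iff, ← b.span_eq, Submodule.span_le]
    rintro _ ⟨d, rfl⟩
    exact (le_iSup (weightSpace H M) (χ d)) (h d)
  · intro ψ
    have hle : weightSpace H M ψ ≤ Submodule.span ℂ (b '' {d | χ d = ψ}) := by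
      intro v hv
      rw [b.mem_span_image]
      intro d hd
      have hd : b.repr v d ≠ 0 := Finsupp.mem_support_iff.mp hd
      refine LinearMap.ext fun x => ?_
      let T : M →ₗ[ℂ] M := LieModule.toEnd ℂ L M (x : L)
      have h1 := repr_of_diagonal b T (fun d => χ d x) (fun d => h d x) v d
      have e : T v = ψ x • v := hv x
      rw [e, map_smul, Finsupp.smul_apply, smul_eq_mul] at h1
      exact (mul_right_cancel₀ hd h1).symm
    have hfin : {d | χ d = ψ}.Finite :=
      Set.Subsingleton.finite fun a ha b hb => hχ (ha.trans hb.symm)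
    have := FiniteDimensional.span_of_finite ℂ (hfin.image b)
    exact Submodule.finiteDimensional_of_le hle

theorem isWeightModule_X (m : ι → ℂ) : IsWeightModule (cartan ι) (X m) := by
  refine isWeightModule_of_basis _ (xBasis m) (fun l => chi l.1)
    (fun l l' h => Subtype.ext (chi_injOn m l.2 l'.2 h)) fun l => ?_
  rw [← xb_coe]
  exact xb_mem_weightSpace l.2

/-- A subspace of `X(μ)` stable under the Cartan subalgebra contains the basis monomials that occur
in its elements. -/
theorem xBasis_mem_of_repr_ne_zero {m : ι → ℂ} (W : Submodule ℂ (X m))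
    (hW : ∀ i j : ι, ∀ w ∈ W, ⁅coroot i j, w⁆ ∈ W) (w : X m) (hw : w ∈ W) (l : xExp m)
    (hl : (xBasis m).repr w l ≠ 0) : xBasis m l ∈ W := by
  induction hn : ((xBasis m).repr w).support.card using Nat.strong_induction_on generalizing w with
  | _ n ih =>
  by_cases h1 : ∃ l' ≠ l, (xBasis m).repr w l' ≠ 0
  · obtain ⟨l', hne, hl'⟩ := h1
    -- A coroot separating the two weights, minus its eigenvalue at l', kills the l'-coefficient,
    -- creates no new ones and keeps the l-coefficient nonzero. The support shrinks until only l is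
    -- left.
    obtain ⟨i, j, hij⟩ : ∃ i j, l.1 i - l.1 j ≠ l'.1 i - l'.1 j := by
      by_contra! h
      refine hne (Subtype.ext (chi_injOn m l.2 l'.2 (cartan_dual_ext fun i j => ?_))).symm
      rw [chi_coroot, chi_coroot, h]
    have hrepr (k : xExp m) : (xBasis m).repr (⁅coroot i j, w⁆ - (l'.1 i - l'.1 j) • w) k =
        ((k.1 i - k.1 j) - (l'.1 i - l'.1 j)) * (xBasis m).repr w k := by
      have h2 : (xBasis m).repr ⁅coroot i j, w⁆ k = (k.1 i - k.1 j) * (xBasis m).repr w k :=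
        repr_of_diagonal (xBasis m) (LieModule.toEnd ℂ (sl ι) (X m) (coroot i j))
          (fun k => k.1 i - k.1 j) (fun d => by rw [← xb_coe]; exact coroot_lie_xb d.2 i j) w k
      rw [map_sub, map_smul, Finsupp.sub_apply, h2, Finsupp.smul_apply, smul_eq_mul]
      ring
    refine ih _ ?_ _ (sub_mem (hW i j w hw) (W.smul_mem (l'.1 i - l'.1 j) hw)) ?_ rfl
    · rw [← hn]
      refine Finset.card_lt_card ((Finset.ssubset_iff_of_subset ?_).mpr ⟨l', ?_, ?_⟩)
      · intro k hk
        rw [Finsupp.mem_support_iff, hrepr] at hk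
        exact Finsupp.mem_support_iff.mpr (right_ne_zero_of_mul hk)
      · exact Finsupp.mem_support_iff.mpr hl'
      · rw [Finsupp.mem_support_iff, hrepr, sub_self, zero_mul, not_not]
    · rw [hrepr]
      exact mul_ne_zero (sub_ne_zero.mpr hij) hl
  · push Not at h1
    have e : w = (xBasis m).repr w l • xBasis m l := by
      apply (xBasis m).repr.injective
      rw [map_smul, Module.Basis.repr_self, Finsupp.smul_single, smul_eq_mul, mul_one]
      refine Finsupp.ext fun k => ?_
      by_cases hk : k = l
      · rw [hk, Finsupp.single_eq_same]
      · rw [h1 k hk, Finsupp.single_eq_of_ne hk]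
    rw [e] at hw
    exact (W.smul_mem_iff hl).mp hw

end Weights

/-! ### Admissible orders -/

section Orders

variable {ι : Type} {r : ι → ι → Prop}

theorem mem_cls_self (r : ι → ι → Prop) (i : ι) : i ∈ cls r i := Or.inl rfl

/-- The element j lies in both [i] and [j], so these sets cannot be disjoint. -/
theorem cls_eq_of_incomparable (hadm : Admissible r) {i j : ι} (h1 : ¬ r i j) (h2 : ¬ r j i) :
    cls r i = cls r j := by
  by_contra h
  have := hadm i j h
  exact (this ▸ (⟨Or.inr ⟨h1, h2⟩, mem_cls_self r j⟩ : j ∈ cls r i ∩ cls r j) : j ∈ (∅ : Set ι))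

theorem incomparable_of_cls_eq (hr : IsStrictOrder ι r) {i j : ι} (h : cls r i = cls r j) :
    ¬ r i j := by
  have : j ∈ cls r i := h ▸ mem_cls_self r j
  rcases this with h | h
  · rw [Set.mem_singleton_iff] at h
    rw [h]; exact hr.toIrrefl.irrefl i
  · exact h.1

/-- If both alternatives fail, transitivity also excludes k ≺ i and j ≺ k. Then k is incomparable
with both i and j, so [i] = [k] = [j], contrary to i ≺ j. -/
theorem Admissible.or_of_rel (hr : IsStrictOrder ι r) (hadm : Admissible r) {i j : ι} (h : r i j)
    (k : ι) : r i k ∨ r k j := by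
  by_contra! hk
  have h1 : ¬ r k i := fun h' => hk.2 (hr.trans _ _ _ h' h)
  have h2 : ¬ r j k := fun h' => hk.1 (hr.trans _ _ _ h h')
  exact incomparable_of_cls_eq hr ((cls_eq_of_incomparable hadm hk.1 h1).trans
    (cls_eq_of_incomparable hadm hk.2 h2)) h

theorem rel_ne (hr : IsStrictOrder ι r) {i j : ι} (h : r i j) : i ≠ j :=
  fun e => hr.toIrrefl.irrefl i (by rw [← e] at h; exact h)

theorem isStrictOrder_restrictOrder {r : ℕ → ℕ → Prop} (hr : IsStrictOrder ℕ r) (n : ℕ) :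
    IsStrictOrder (Fin n) (restrictOrder r n) where
  irrefl i := hr.toIrrefl.irrefl i
  trans _ _ _ := hr.trans _ _ _

theorem cls_restrictOrder (r : ℕ → ℕ → Prop) (n : ℕ) (i : Fin n) :
    cls (restrictOrder r n) i = {j : Fin n | (j : ℕ) ∈ cls r i} := by
  ext j
  exact or_congr Fin.ext_iff Iff.rfl

theorem admissible_restrictOrder {r : ℕ → ℕ → Prop} (hadm : Admissible r) (n : ℕ) :
    Admissible (restrictOrder r n) := by
  intro i j h
  rw [cls_restrictOrder, cls_restrictOrder] at h ⊢
  have h' : cls r i ≠ cls r j := fun e => h (by rw [e])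
  refine Set.eq_empty_of_forall_notMem fun k hk => ?_
  have : (k : ℕ) ∈ cls r i ∩ cls r j := hk
  rwa [hadm _ _ h'] at this

theorem mem_intPlus_of_eq_zero {l : ι → ℂ} {i : ι} (h : l i = 0) : i ∈ intPlus l :=
  ⟨0, le_rfl, by rw [h, Int.cast_zero]⟩

theorem notMem_intPlus_of_neg {l : ι → ℂ} {i : ι} {k : ℤ} (hk : k < 0) (h : l i = k) :
    i ∉ intPlus l := by
  rintro ⟨k', hk', h'⟩
  have : k = k' := by exact_mod_cast h.symm.trans h'
  omega

end Orders

/-! ### Monomials killed by the nilradical -/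

section Invariants

variable {ι : Type} [DecidableEq ι] {r : ι → ι → Prop}

/-- The exponents of the basis monomials of `X(μ)` that are killed by all `E_ij` with `i ≺ j`. -/
def invExp (r : ι → ι → Prop) (m : ι → ℂ) : Set (ι → ℂ) :=
  {l | l ∈ xExp m ∧ ∀ i j, r i j → l j = 0 ∨ l i = -1}

theorem add_sub_eps_same_left (l : ι → ℂ) {i j : ι} (h : i ≠ j) :
    (l + eps i - eps j) i = l i + 1 := by simp [eps, h]

theorem add_sub_eps_same_right (l : ι → ℂ) {i j : ι} (h : i ≠ j) :
    (l + eps i - eps j) j = l j - 1 := by simp [eps, h.symm]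

theorem add_sub_eps_of_ne (l : ι → ℂ) {i j k : ι} (hi : k ≠ i) (hj : k ≠ j) :
    (l + eps i - eps j) k = l k := by simp [eps, hi, hj]

/-- Raising an entry from -1 to 0 would add i to Int⁺, which is the same for all basis exponents. -/
theorem ne_neg_one_of_add_mem {m l : ι → ℂ} (hl : l ∈ xExp m) {i j : ι} (h : i ≠ j)
    (hl' : l + eps i - eps j ∈ xExp m) : l i ≠ -1 := by
  intro e
  have h1 : i ∈ intPlus (l + eps i - eps j) :=
    mem_intPlus_of_eq_zero (by rw [add_sub_eps_same_left l h, e]; ring)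
  rw [hl'.2, ← hl.2] at h1
  exact notMem_intPlus_of_neg (k := -1) (by norm_num) (by rw [e]; norm_num) h1

/-- A step along a root of 𝔭(≺) can break the condition for i ≺ j only when j = k with λ_k = 0, or i
= q with λ_q = -1. In the first case i ≺ k and not q ≺ k give i ≺ q; since λ_q ≠ 0, the condition
for that pair says λ_i = -1. The second case is symmetric, through k ≺ j. -/
theorem add_mem_invExp (hr : IsStrictOrder ι r) (hadm : Admissible r) {m l : ι → ℂ}
    (hl : l ∈ invExp r m) {k q : ι} (hkq : k ≠ q) (hrel : ¬ r q k) (hq : l q ≠ 0)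
    (hl' : l + eps k - eps q ∈ xExp m) : l + eps k - eps q ∈ invExp r m := by
  have hk := ne_neg_one_of_add_mem hl.1 hkq hl'
  refine ⟨hl', fun i j hij => ?_⟩
  rcases hl.2 i j hij with hj | hi
  · have hjq : j ≠ q := fun e => hq (e ▸ hj)
    by_cases hjk : j = k
    · subst hjk
      have hiq := (hadm.or_of_rel hr hij q).resolve_right hrel
      exact Or.inr (by
        rw [add_sub_eps_of_ne l (rel_ne hr hij) (rel_ne hr hiq)]
        exact (hl.2 i q hiq).resolve_left hq)
    · exact Or.inl (by rw [add_sub_eps_of_ne l hjk hjq, hj])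
  · have hik : i ≠ k := fun e => hk (e ▸ hi)
    by_cases hiq : i = q
    · subst hiq
      have hkj := (hadm.or_of_rel hr hij k).resolve_left hrel
      exact Or.inl (by
        rw [add_sub_eps_of_ne l (rel_ne hr hkj).symm (rel_ne hr hij).symm]
        exact (hl.2 k j hkj).resolve_right hk)
    · exact Or.inr (by rw [add_sub_eps_of_ne l hik hiq, hi])

theorem rootVec_lie_mem_span_invExp (hr : IsStrictOrder ι r) (hadm : Admissible r) (m : ι → ℂ)
    {k q : ι} (hkq : k ≠ q) (hrel : ¬ r q k) {w : X m}
    (hw : w ∈ Submodule.span ℂ (xb m '' invExp r m)) :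
    ⁅rootVec k q hkq, w⁆ ∈ Submodule.span ℂ (xb m '' invExp r m) := by
  have h : Submodule.span ℂ (xb m '' invExp r m) ≤ (Submodule.span ℂ (xb m '' invExp r m)).comap
      (LieModule.toEnd ℂ (sl ι) (X m) (rootVec k q hkq)) := by
    refine Submodule.span_le.mpr ?_
    rintro _ ⟨l, hl, rfl⟩
    change ⁅rootVec k q hkq, xb m l⁆ ∈ Submodule.span ℂ (xb m '' invExp r m)
    rw [rootVec_lie_xb hl.1]
    by_cases h0 : l q = 0
    · rw [h0, zero_smul]; exact zero_mem _
    by_cases h1 : l + eps k - eps q ∈ xExp m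
    · exact Submodule.smul_mem _ _
        (Submodule.subset_span ⟨_, add_mem_invExp hr hadm hl hkq hrel h0 h1, rfl⟩)
    · rw [xb_of_notMem h1, smul_zero]; exact zero_mem _
  exact h hw

theorem rootVec_lie_eq_zero (m : ι → ℂ) {i j : ι} (hij : i ≠ j)
    (hrel : r i j) {w : X m} (hw : w ∈ Submodule.span ℂ (xb m '' invExp r m)) :
    ⁅rootVec i j hij, w⁆ = 0 := by
  have h : Submodule.span ℂ (xb m '' invExp r m) ≤
      LinearMap.ker (LieModule.toEnd ℂ (sl ι) (X m) (rootVec i j hij)) := by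
    refine Submodule.span_le.mpr ?_
    rintro _ ⟨l, hl, rfl⟩
    change ⁅rootVec i j hij, xb m l⁆ = 0
    rw [rootVec_lie_xb hl.1]
    rcases hl.2 i j hrel with h0 | h1
    · rw [h0, zero_smul]
    · rw [xb_of_notMem fun h => ne_neg_one_of_add_mem hl.1 hij h h1, smul_zero]
  exact h hw

theorem cartan_lie_mem_span_invExp (m : ι → ℂ) {x : sl ι} (hx : x ∈ cartan ι) {w : X m}
    (hw : w ∈ Submodule.span ℂ (xb m '' invExp r m)) :
    ⁅x, w⁆ ∈ Submodule.span ℂ (xb m '' invExp r m) := by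
  have h : Submodule.span ℂ (xb m '' invExp r m) ≤ (Submodule.span ℂ (xb m '' invExp r m)).comap
      (LieModule.toEnd ℂ (sl ι) (X m) x) := by
    refine Submodule.span_le.mpr ?_
    rintro _ ⟨l, hl, rfl⟩
    change ⁅x, xb m l⁆ ∈ Submodule.span ℂ (xb m '' invExp r m)
    rw [cartan_lie_xb hl.1 ⟨x, hx⟩]
    exact Submodule.smul_mem _ _ (Submodule.subset_span ⟨l, hl, rfl⟩)
  exact h hw

/-- The subalgebra of the elements that map a subspace `N` to a smaller one. -/
def transporter {L M : Type} [LieRing L] [LieAlgebra ℂ L] [AddCommGroup M] [Module ℂ M]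
    [LieRingModule L M] [LieModule ℂ L M] (N N' : Submodule ℂ M) (h : N' ≤ N) :
    LieSubalgebra ℂ L where
  carrier := {x | ∀ s ∈ N, ⁅x, s⁆ ∈ N'}
  add_mem' ha hb s hs := by rw [add_lie]; exact add_mem (ha s hs) (hb s hs)
  zero_mem' s _ := by rw [zero_lie]; exact zero_mem _
  smul_mem' c x hx s hs := by rw [smul_lie]; exact N'.smul_mem c (hx s hs)
  lie_mem' {x y} hx hy s hs := by
    rw [lie_lie]
    exact sub_mem (hx _ (h (hy s hs))) (hy _ (h (hx s hs)))

/-- The `𝔭(≺)`-submodule of `X(μ)` spanned by the basis monomials killed by `𝔲(≺)`. -/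
def invSub (hr : IsStrictOrder ι r) (hadm : Admissible r) (m : ι → ℂ) :
    LieSubmodule ℂ (parabolic r) (X m) where
  __ := Submodule.span ℂ (xb m '' invExp r m)
  lie_mem {x w} hw := by
    have h : parabolic r ≤ transporter (Submodule.span ℂ (xb m '' invExp r m)) _ le_rfl := by
      refine LieSubalgebra.lieSpan_le.mpr ?_
      rintro x (hx | ⟨i, j, hij, hrel, rfl⟩) s hs
      · exact cartan_lie_mem_span_invExp m hx hs
      · refine rootVec_lie_mem_span_invExp hr hadm m hij (fun h => ?_) hs
        rcases hrel with h' | h'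
        · exact hr.toIrrefl.irrefl _ (hr.trans _ _ _ h h')
        · exact h'.2 h
    exact h x.2 w hw

theorem nilradical_lie_eq_zero (m : ι → ℂ) {x : sl ι}
    (hx : x ∈ nilradical r) {w : X m} (hw : w ∈ Submodule.span ℂ (xb m '' invExp r m)) :
    ⁅x, w⁆ = 0 := by
  have h : nilradical r ≤ transporter (Submodule.span ℂ (xb m '' invExp r m)) ⊥ bot_le := by
    refine LieSubalgebra.lieSpan_le.mpr ?_
    rintro x ⟨i, j, hij, hrel, rfl⟩ s hs
    exact (Submodule.mem_bot ℂ).mpr (rootVec_lie_eq_zero m hij hrel hs)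
  exact h hx w hw

end Invariants

/-! ### Simplicity -/

section Simple

variable {ι : Type} [DecidableEq ι] {r : ι → ι → Prop}

/-- Int⁺ changes only if entry j passes from 0 to -1 or entry i from -1 to 0, and both are excluded.
-/
theorem add_sub_eps_mem_xExp {m l : ι → ℂ} (hl : l ∈ xExp m) {i j : ι} (hij : i ≠ j)
    (hj : l j ≠ 0) (hi : l i ≠ -1) : l + eps i - eps j ∈ xExp m := by
  refine ⟨?_, ?_⟩
  · have e : l + eps i - eps j - m = (l - m) + (eps i - eps j) := by abel
    rw [e]; exact add_mem hl.1 (eps_sub_mem i j)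
  · rw [← hl.2]
    ext t
    by_cases htj : t = j
    · subst htj
      constructor
      · rintro ⟨k, hk, h⟩
        rw [add_sub_eps_same_right l hij] at h
        exact ⟨k + 1, by omega, by push_cast; linear_combination h⟩
      · rintro ⟨k, hk, h⟩
        have : k ≠ 0 := by rintro rfl; exact hj (by rw [h, Int.cast_zero])
        refine ⟨k - 1, by omega, ?_⟩
        rw [add_sub_eps_same_right l hij, h]
        push_cast
        ring
    by_cases hti : t = i
    · subst hti
      constructor
      · rintro ⟨k, hk, h⟩
        rw [add_sub_eps_same_left l hij] at h
        have : k ≠ 0 := by rintro rfl; exact hi (by rw [Int.cast_zero] at h; linear_combination h)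
        exact ⟨k - 1, by omega, by push_cast; linear_combination h⟩
      · rintro ⟨k, hk, h⟩
        refine ⟨k + 1, by omega, ?_⟩
        rw [add_sub_eps_same_left l hij, h]
        push_cast
        ring
    · unfold intPlus
      rw [Set.mem_ofPred_eq, Set.mem_ofPred_eq, add_sub_eps_of_ne l hti htj]

/-- If p ≺ q, invariance of l' gives l'_q = 0 or l'_p = -1; then l has a negative entry at q, or a
nonnegative one at p, contradicting the equality of Int⁺. If q ≺ p, the same argument uses the
invariance of l. So getting from l to l' requires only roots of 𝔩(≺). -/
theorem incomparable_of_invExp {m l l' : ι → ℂ} (hl : l ∈ invExp r m) (hl' : l' ∈ invExp r m)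
    {f : ι → ℤ} (hf : ∀ i, l' i = l i + f i) {p q : ι} (hp : f p < 0) (hq : 0 < f q) :
    ¬ r p q ∧ ¬ r q p := by
  have hmem : ∀ t, t ∈ intPlus l ↔ t ∈ intPlus l' := fun t => by rw [hl.1.2, hl'.1.2]
  refine ⟨fun h => ?_, fun h => ?_⟩
  · rcases hl'.2 p q h with h0 | h0
    · refine notMem_intPlus_of_neg (l := l) (i := q) (k := -f q) (by omega) ?_
        ((hmem q).mpr (mem_intPlus_of_eq_zero h0))
      push_cast
      linear_combination h0 - hf q
    · refine notMem_intPlus_of_neg (l := l') (i := p) (k := -1) (by omega) (by rw [h0]; norm_num)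
        ((hmem p).mp ⟨-1 - f p, by omega, ?_⟩)
      push_cast
      linear_combination h0 - hf p
  · rcases hl.2 q p h with h0 | h0
    · refine notMem_intPlus_of_neg (l := l') (i := p) (k := f p) hp ?_
        ((hmem p).mp (mem_intPlus_of_eq_zero h0))
      linear_combination h0 + hf p
    · refine notMem_intPlus_of_neg (l := l) (i := q) (k := -1) (by omega) (by rw [h0]; norm_num)
        ((hmem q).mpr ⟨f q - 1, by omega, ?_⟩)
      push_cast
      linear_combination h0 + hf q

theorem xb_mem_of_levi_stable (hr : IsStrictOrder ι r) (hadm : Admissible r) {m : ι → ℂ}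
    (W : Submodule ℂ (X m))
    (hW : ∀ (i j : ι) (h : i ≠ j), ¬ r i j → ¬ r j i → ∀ w ∈ W, ⁅rootVec i j h, w⁆ ∈ W)
    {l l' : ι → ℂ} (hl : l ∈ invExp r m) (hl' : l' ∈ invExp r m) (hlW : xb m l ∈ W) :
    xb m l' ∈ W := by
  -- Induction on the ℓ¹-distance between l and l'. With f_p < 0 < f_q, the vector E_qp belongs to
  -- 𝔩(≺) and moves l by ε_q - ε_p towards l', with coefficient l_p ≠ 0. The finite set T stays
  -- fixed while the support of f may shrink.
  have key : ∀ (n : ℕ) (T : Finset ι) (f : ι → ℤ) (l : ι → ℂ), l ∈ invExp r m → xb m l ∈ W →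
      (∀ i, l' i = l i + f i) → (∀ i, i ∉ T → f i = 0) → ∑ i ∈ T, f i = 0 →
      ∑ i ∈ T, (f i).natAbs = n → xb m l' ∈ W := by
    intro n
    induction n using Nat.strong_induction_on with
    | _ n ih =>
    intro T f l hl hlW hf hT hsum hn
    by_cases h0 : ∀ i ∈ T, f i = 0
    · have : l' = l := funext fun i => by
        rw [hf]
        by_cases hi : i ∈ T
        · rw [h0 i hi]; simp
        · rw [hT i hi]; simp
      rwa [this]
    push Not at h0
    obtain ⟨p, hpT, hp⟩ := Finset.exists_pos_of_sum_zero_of_exists_nonzero (fun i => -f i)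
      (by rw [Finset.sum_neg_distrib, hsum, neg_zero])
      (h0.imp fun i hi => ⟨hi.1, neg_ne_zero.mpr hi.2⟩)
    replace hp : f p < 0 := neg_pos.mp hp
    obtain ⟨q, hqT, hq⟩ := Finset.exists_pos_of_sum_zero_of_exists_nonzero f hsum h0
    have hqp : q ≠ p := by rintro rfl; omega
    obtain ⟨hi1, hi2⟩ := incomparable_of_invExp hl hl' hf hp hq
    have hlp : l p ≠ 0 := by
      intro e
      have : p ∈ intPlus l' := by
        rw [hl'.1.2, ← hl.1.2]; exact mem_intPlus_of_eq_zero e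
      refine notMem_intPlus_of_neg hp ?_ this
      linear_combination e + hf p
    have hlq : l q ≠ -1 := by
      intro e
      refine notMem_intPlus_of_neg (l := l) (i := q) (k := -1) (by omega) (by rw [e]; norm_num) ?_
      rw [hl.1.2, ← hl'.1.2]
      refine ⟨f q - 1, by omega, ?_⟩
      push_cast
      linear_combination e + hf q
    have h2 := add_mem_invExp hr hadm hl hqp hi1 hlp (add_sub_eps_mem_xExp hl.1 hqp hlp hlq)
    have h3 := hW q p hqp hi2 hi1 _ hlW
    rw [rootVec_lie_xb hl.1, W.smul_mem_iff hlp] at h3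
    have hg (i : ι) : ((eps q - eps p : ι → ℂ) i) =
      (((if i = q then 1 else 0) - (if i = p then 1 else 0) : ℤ) : ℂ) := eps_sub_apply q p i
    refine ih _ ?_ T (fun i => f i - ((if i = q then 1 else 0) - (if i = p then 1 else 0))) _ h2 h3
      (fun i => ?_) (fun i hi => ?_) ?_ rfl
    · rw [← hn]
      refine Finset.sum_lt_sum (fun i _ => ?_) ⟨p, hpT, ?_⟩
      · by_cases e1 : i = q
        · subst e1; rw [if_pos rfl, if_neg hqp]; omega
        · by_cases e2 : i = p
          · subst e2; rw [if_neg e1, if_pos rfl]; omega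
          · rw [if_neg e1, if_neg e2]; simp
      · rw [if_neg hqp.symm, if_pos rfl]; omega
    · have e : (l + eps q - eps p) i = l i + (eps q - eps p : ι → ℂ) i := by
        rw [add_sub_assoc, Pi.add_apply]
      rw [e, hg, hf]
      push_cast
      ring
    · rw [hT i hi, if_neg (fun e : i = q => hi (by rw [e]; exact hqT)),
        if_neg (fun e : i = p => hi (by rw [e]; exact hpT))]; rfl
    · rw [Finset.sum_sub_distrib, hsum, Finset.sum_sub_distrib, Finset.sum_ite_eq', if_pos hqT,
        Finset.sum_ite_eq', if_pos hpT]
      rfl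
  have hmem : l' - l ∈ rootLattice ι := by
    have e : l' - l = (l' - m) - (l - m) := by abel
    rw [e]; exact sub_mem hl'.1.1 hl.1.1
  obtain ⟨f, hf, hfl⟩ := mem_rootLattice_iff.mp hmem
  exact key _ f.support f l hl hlW (fun i => by rw [← hfl, Pi.sub_apply, add_sub_cancel])
    (fun i hi => Finsupp.notMem_support_iff.mp hi) hf rfl

theorem mem_span_xb_iff {m : ι → ℂ} {s : Set (ι → ℂ)} (hs : s ⊆ xExp m) {w : X m} :
    w ∈ Submodule.span ℂ (xb m '' s) ↔ ∀ l : xExp m, (xBasis m).repr w l ≠ 0 → l.1 ∈ s := by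
  have e : xb m '' s = xBasis m '' {l | l.1 ∈ s} := by
    ext v
    constructor
    · rintro ⟨l, hl, rfl⟩; exact ⟨⟨l, hs hl⟩, hl, (xb_of_mem (hs hl)).symm⟩
    · rintro ⟨l, hl, rfl⟩; exact ⟨l.1, hl, xb_coe m l⟩
  rw [e, Module.Basis.mem_span_image]
  exact forall_congr' fun l => imp_congr_left Finsupp.mem_support_iff

/-- The span of the monomials killed by `𝔲(≺)` is a simple `𝔩(≺)`-module. -/
theorem eq_bot_or_eq_of_levi_stable (hr : IsStrictOrder ι r) (hadm : Admissible r) {m : ι → ℂ}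
    (W : Submodule ℂ (X m)) (hle : W ≤ Submodule.span ℂ (xb m '' invExp r m))
    (hC : ∀ i j : ι, ∀ w ∈ W, ⁅coroot i j, w⁆ ∈ W)
    (hW : ∀ (i j : ι) (h : i ≠ j), ¬ r i j → ¬ r j i → ∀ w ∈ W, ⁅rootVec i j h, w⁆ ∈ W) :
    W = ⊥ ∨ W = Submodule.span ℂ (xb m '' invExp r m) := by
  by_cases hbot : W = ⊥
  · exact Or.inl hbot
  · obtain ⟨w, hw, hw0⟩ := W.ne_bot_iff.mp hbot
    obtain ⟨l, hl⟩ : ∃ l, (xBasis m).repr w l ≠ 0 := by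
      by_contra! h
      exact hw0 ((xBasis m).repr.map_eq_zero_iff.mp (Finsupp.ext h))
    have hl' := (mem_span_xb_iff fun l h => h.1).mp (hle hw) l hl
    have hlW := xBasis_mem_of_repr_ne_zero W hC w hw l hl
    rw [← xb_coe] at hlW
    refine Or.inr (le_antisymm hle (Submodule.span_le.mpr ?_))
    rintro _ ⟨l', h', rfl⟩
    exact xb_mem_of_levi_stable hr hadm W hW hl' h' hlW

theorem span_xb_eq_top (m : ι → ℂ) : Submodule.span ℂ (xb m '' xExp m) = ⊤ :=
  eq_top_iff.mpr fun _ _ => (mem_span_xb_iff subset_rfl).mpr fun l _ => l.2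

/-- For the empty order every basis exponent is invariant and no two indices are comparable, so this
is the simplicity over 𝔩(≺) in that special case. -/
theorem isIrreducible_X (m : ι → ℂ) : LieModule.IsIrreducible ℂ (sl ι) (X m) := by
  have : Nontrivial (X m) := ⟨_, _, xb_ne_zero (self_mem_xExp m)⟩
  refine LieModule.IsIrreducible.mk fun N hN => ?_
  have e : invExp (fun _ _ : ι => False) m = xExp m := by
    ext l; exact ⟨fun h => h.1, fun h => ⟨h, fun _ _ h => h.elim⟩⟩
  have hr : IsStrictOrder ι fun _ _ => False :=
    { irrefl := fun _ h => h, trans := fun _ _ _ h => h.elim }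
  have hadm : Admissible fun _ _ : ι => False := fun i j h => by
    refine absurd ?_ h
    ext k; simp [cls]
  rcases eq_bot_or_eq_of_levi_stable hr hadm N.toSubmodule
    (by rw [e, span_xb_eq_top]; exact le_top) (fun i j w hw => N.lie_mem hw)
    (fun i j h _ _ w hw => N.lie_mem hw) with h | h
  · exact absurd (LieSubmodule.toSubmodule_eq_bot N |>.mp h) hN
  · rw [e, span_xb_eq_top] at h
    exact (LieSubmodule.toSubmodule_eq_top _).mp h

end Simple

/-! ### The universal property of generalized Verma modules -/

section VermaLift

attribute [local instance] LieRing.ofAssociativeRing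

variable {L : Type} [LieRing L] [LieAlgebra ℂ L] (P : LieSubalgebra ℂ L)
variable {S : Type} [AddCommGroup S] [Module ℂ S] [LieRingModule P S]
variable {M : Type} [AddCommGroup M] [Module ℂ M] [LieRingModule L M] [LieModule ℂ L M]

/-- The action of the enveloping algebra on a module. -/
def ueaAction (L M : Type) [LieRing L] [LieAlgebra ℂ L] [AddCommGroup M] [Module ℂ M]
    [LieRingModule L M] [LieModule ℂ L M] :
    UniversalEnvelopingAlgebra ℂ L →ₐ[ℂ] Module.End ℂ M :=
  UniversalEnvelopingAlgebra.lift ℂ (LieModule.toEnd ℂ L M)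

theorem ueaAction_ι (x : L) (v : M) :
    ueaAction L M (UniversalEnvelopingAlgebra.ι ℂ x) v = ⁅x, v⁆ := by
  rw [ueaAction, UniversalEnvelopingAlgebra.lift_ι_apply]
  rfl

/-- The map `u ⊗ s ↦ u φ(s)`. -/
def tensorAction (φ : S →ₗ[ℂ] M) : UniversalEnvelopingAlgebra ℂ L ⊗[ℂ] S →ₗ[ℂ] M :=
  TensorProduct.lift ((LinearMap.lcomp ℂ M φ) ∘ₗ (ueaAction L M).toLinearMap)

theorem tensorAction_tmul (φ : S →ₗ[ℂ] M) (u : UniversalEnvelopingAlgebra ℂ L) (s : S) :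
    tensorAction φ (u ⊗ₜ s) = ueaAction L M u (φ s) := rfl

theorem tensorAction_smul (φ : S →ₗ[ℂ] M) (u : UniversalEnvelopingAlgebra ℂ L)
    (t : UniversalEnvelopingAlgebra ℂ L ⊗[ℂ] S) :
    tensorAction φ (u • t) = ueaAction L M u (tensorAction φ t) := by
  induction t using TensorProduct.induction_on with
  | zero => rw [smul_zero, map_zero, map_zero]
  | tmul v s =>
    rw [TensorProduct.smul_tmul', tensorAction_tmul, tensorAction_tmul, smul_eq_mul, map_mul]
    rfl
  | add a b ha hb => rw [smul_add, map_add, ha, hb, map_add, map_add]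

theorem vermaRel_le_ker (φ : S →ₗ[ℂ] M) (hφ : ∀ (p : P) (s : S), φ ⁅p, s⁆ = ⁅(p : L), φ s⁆) :
    (vermaRel P S).restrictScalars ℂ ≤ LinearMap.ker (tensorAction φ) := by
  intro t ht
  refine Submodule.span_induction (p := fun t _ => tensorAction φ t = 0) ?_ ?_ ?_ ?_
    (show t ∈ vermaRel P S from ht)
  · rintro _ ⟨u, p, s, rfl⟩
    rw [map_sub, tensorAction_tmul, tensorAction_tmul, map_mul, hφ, ← ueaAction_ι]
    exact sub_self _
  · exact map_zero _
  · intro a b _ _ ha hb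
    rw [map_add, ha, hb, add_zero]
  · intro u a _ ha
    rw [tensorAction_smul, ha, map_zero]

/-- A `P`-equivariant map `S → M` extends to the induced module. -/
def GenVerma.lift (φ : S →ₗ[ℂ] M) (hφ : ∀ (p : P) (s : S), φ ⁅p, s⁆ = ⁅(p : L), φ s⁆) :
    GenVerma P S →ₗ⁅ℂ, L⁆ M where
  __ := ((vermaRel P S).restrictScalars ℂ).liftQ (tensorAction φ) (vermaRel_le_ker P φ hφ) ∘ₗ
    (Submodule.Quotient.restrictScalarsEquiv ℂ (vermaRel P S)).symm.toLinearMap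
  map_lie' {x v} := by
    induction v using Submodule.Quotient.induction_on with
    | _ t =>
    change tensorAction φ (UniversalEnvelopingAlgebra.ι ℂ x • t) = ⁅x, tensorAction φ t⁆
    rw [tensorAction_smul, ueaAction_ι]

/-- The element `1 ⊗ s` of the induced module. -/
def GenVerma.of (s : S) : GenVerma P S :=
  (vermaRel P S).mkQ ((1 : UniversalEnvelopingAlgebra ℂ L) ⊗ₜ s)

theorem GenVerma.lift_of (φ : S →ₗ[ℂ] M) (hφ : ∀ (p : P) (s : S), φ ⁅p, s⁆ = ⁅(p : L), φ s⁆)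
    (s : S) : GenVerma.lift P φ hφ (GenVerma.of P s) = φ s := by
  change tensorAction φ ((1 : UniversalEnvelopingAlgebra ℂ L) ⊗ₜ s) = φ s
  rw [tensorAction_tmul, map_one]
  rfl

theorem GenVerma.lie_of (p : P) (s : S) :
    ⁅(p : L), GenVerma.of P s⁆ = GenVerma.of P ⁅p, s⁆ := by
  change (vermaRel P S).mkQ (UniversalEnvelopingAlgebra.ι ℂ (p : L) •
    ((1 : UniversalEnvelopingAlgebra ℂ L) ⊗ₜ s)) = _
  refine (Submodule.Quotient.eq _).mpr ?_
  rw [TensorProduct.smul_tmul', smul_eq_mul, mul_one]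
  exact Submodule.subset_span ⟨1, p, s, by rw [one_mul]⟩

/-- It suffices to check generators, since the enveloping algebra is a quotient of the tensor
algebra. -/
theorem GenVerma.map_smul (f : GenVerma P S →ₗ⁅ℂ, L⁆ M) (u : UniversalEnvelopingAlgebra ℂ L)
    (v : GenVerma P S) : f (u • v) = ueaAction L M u (f v) := by
  obtain ⟨t, rfl⟩ : ∃ t, UniversalEnvelopingAlgebra.mkAlgHom ℂ L t = u :=
    RingCon.mk'_surjective _ u
  induction t using TensorAlgebra.induction generalizing v with
  | algebraMap c =>
    rw [AlgHom.commutes, AlgHom.commutes, Module.algebraMap_end_apply, algebraMap_smul,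
      _root_.map_smul]
  | ι x =>
    rw [← UniversalEnvelopingAlgebra.ι_apply, ueaAction_ι]
    exact LieModuleHom.map_lie f x v
  | mul a b ha hb => rw [map_mul, map_mul, Module.End.mul_apply, mul_smul, ha, hb]
  | add a b ha hb => rw [map_add, map_add, LinearMap.add_apply, add_smul, map_add, ha, hb]

/-- The vectors 1 ⊗ s generate the induced module over the enveloping algebra. -/
theorem GenVerma.eq_zero_of_of_eq_zero (f : GenVerma P S →ₗ⁅ℂ, L⁆ M)
    (h : ∀ s, f (GenVerma.of P s) = 0) (v : GenVerma P S) : f v = 0 := by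
  induction v using Submodule.Quotient.induction_on with
  | _ t =>
  induction t using TensorProduct.induction_on with
  | zero => exact map_zero f
  | tmul u s =>
    have e : (u ⊗ₜ[ℂ] s : UniversalEnvelopingAlgebra ℂ L ⊗[ℂ] S) = u • (1 ⊗ₜ[ℂ] s) := by
      rw [TensorProduct.smul_tmul', smul_eq_mul, mul_one]
    have e' : (Submodule.Quotient.mk (u ⊗ₜ[ℂ] s) : GenVerma P S) = u • GenVerma.of P s := by
      rw [e]; rfl
    exact (congrArg f e').trans (by rw [GenVerma.map_smul, h, map_zero])
  | add a b ha hb => exact (map_add f _ _).trans ((congrArg₂ _ ha hb).trans (add_zero 0))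

end VermaLift

/-! ### Aligned modules and vectors killed by the nilradical -/

section Aligned

variable {ι : Type} {r : ι → ι → Prop}

theorem cartan_le_parabolic (r : ι → ι → Prop) {x : sl ι} (hx : x ∈ cartan ι) :
    x ∈ parabolic r := LieSubalgebra.subset_lieSpan (Or.inl hx)

theorem cartan_le_levi (r : ι → ι → Prop) {x : sl ι} (hx : x ∈ cartan ι) :
    x ∈ levi r := LieSubalgebra.subset_lieSpan (Or.inl hx)

/-- Some 1 ⊗ s has nonzero image because these vectors generate, and 𝔲(≺) kills 1 ⊗ s because it
kills S. -/
theorem IsAligned.exists_killed {M : Type} [AddCommGroup M] [Module ℂ M]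
    [LieRingModule (sl ι) M] [LieModule ℂ (sl ι) M] (h : IsAligned r M) :
    ∃ v : M, v ≠ 0 ∧ ∀ (i j : ι) (hij : i ≠ j), r i j → ⁅rootVec i j hij, v⁆ = 0 := by
  obtain ⟨hirr, -, S, _, _, _, _, hS, f, hf⟩ := h
  obtain ⟨s, hs⟩ : ∃ s, f (GenVerma.of (parabolic r) s) ≠ 0 := by
    by_contra! h0
    have hM : Nontrivial M := (LieSubmodule.nontrivial_iff ℂ (sl ι) M).mp inferInstance
    obtain ⟨v, hv⟩ := exists_ne (0 : M)
    obtain ⟨w, rfl⟩ := hf v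
    exact hv (GenVerma.eq_zero_of_of_eq_zero _ f h0 w)
  refine ⟨_, hs, fun i j hij hrel => ?_⟩
  have hp : rootVec i j hij ∈ parabolic r :=
    LieSubalgebra.subset_lieSpan (Or.inr ⟨i, j, hij, Or.inl hrel, rfl⟩)
  have hn : rootVec i j hij ∈ nilradical r :=
    LieSubalgebra.subset_lieSpan ⟨i, j, hij, hrel, rfl⟩
  rw [← LieModuleHom.map_lie]
  have e := GenVerma.lie_of (parabolic r) ⟨_, hp⟩ s
  rw [hS.nilradical_lie ⟨_, hp⟩ hn s] at e
  refine (congrArg f e).trans ?_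
  have e0 : GenVerma.of (parabolic r) (0 : S) = 0 := by
    rw [GenVerma.of, TensorProduct.tmul_zero, map_zero]
    rfl
  rw [e0, map_zero]

variable [DecidableEq ι]

theorem isInducing_invSub (hr : IsStrictOrder ι r) (hadm : Admissible r) {m : ι → ℂ}
    (hne : (invExp r m).Nonempty) : IsInducing r (invSub hr hadm m) where
  nilradical_lie x hx s := Subtype.ext (nilradical_lie_eq_zero m hx s.2)
  nontrivial := by
    obtain ⟨l, hl⟩ := hne
    exact ⟨⟨xb m l, Submodule.subset_span ⟨l, hl, rfl⟩⟩, 0,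
      fun h => xb_ne_zero hl.1 (congrArg Subtype.val h)⟩
  simple W hW := by
    have hst : ∀ x ∈ levi r, x ∈ parabolic r → ∀ w ∈ W.map (invSub hr hadm m).toSubmodule.subtype,
        ⁅x, w⁆ ∈ W.map (invSub hr hadm m).toSubmodule.subtype := by
      rintro x hx hx' _ ⟨w, hw, rfl⟩
      exact ⟨_, hW ⟨x, hx'⟩ hx w hw, rfl⟩
    have hle : W.map (invSub hr hadm m).toSubmodule.subtype ≤
        Submodule.span ℂ (xb m '' invExp r m) := by
      rintro _ ⟨w, -, rfl⟩
      exact w.2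
    rcases eq_bot_or_eq_of_levi_stable hr hadm _ hle
      (fun i j => hst _ (cartan_le_levi r (coroot_mem_cartan i j))
        (cartan_le_parabolic r (coroot_mem_cartan i j)))
      (fun i j hij h1 h2 => hst _
        (LieSubalgebra.subset_lieSpan (Or.inr ⟨i, j, hij, ⟨h1, h2⟩, rfl⟩))
        (LieSubalgebra.subset_lieSpan (Or.inr ⟨i, j, hij, Or.inr ⟨h1, h2⟩, rfl⟩))) with h | h
    · refine Or.inl (eq_bot_iff.mpr fun w hw => ?_)
      have hw' : w.1 ∈ W.map (invSub hr hadm m).toSubmodule.subtype := ⟨w, hw, rfl⟩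
      rw [h] at hw'
      exact Subtype.ext ((Submodule.mem_bot ℂ).mp hw')
    · refine Or.inr (eq_top_iff.mpr fun w _ => ?_)
      have hw : w.1 ∈ W.map (invSub hr hadm m).toSubmodule.subtype := by rw [h]; exact w.2
      obtain ⟨w', hw', e⟩ := hw
      rwa [← Subtype.ext (show w'.1 = w.1 from e)]
  weight := by
    let b₀ : invExp r m → X m := fun l => xb m l.1
    have hli : LinearIndependent ℂ b₀ := by
      have e : b₀ = xBasis m ∘ fun l : invExp r m => (⟨l.1, l.2.1⟩ : xExp m) :=
        funext fun l => xb_of_mem l.2.1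
      rw [e]
      exact (xBasis m).linearIndependent.comp _ fun a b h =>
        Subtype.ext (congrArg (fun t : xExp m => t.1) h)
    have hspan : Submodule.span ℂ (Set.range b₀) = (invSub hr hadm m).toSubmodule := by
      change _ = Submodule.span ℂ (xb m '' invExp r m)
      rw [Set.image_eq_range]
    let b : Module.Basis (invExp r m) ℂ (invSub hr hadm m) :=
      (Module.Basis.span hli).map (LinearEquiv.ofEq _ _ hspan)
    have hb : ∀ l, (b l : X m) = xb m l.1 := fun l => congrArg Subtype.val (Module.Basis.span_apply hli l)
    let H := (cartan ι).comap ((parabolic r).incl : parabolic r →ₗ[ℂ] sl ι)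
    let π : H →ₗ[ℂ] cartan ι :=
      ((parabolic r).incl : parabolic r →ₗ[ℂ] sl ι).restrict fun x hx => hx
    -- The Cartan subalgebra lies in 𝔭(≺), so pulling weights back along π keeps them distinct.
    refine isWeightModule_of_basis _ b (fun l => chi l.1 ∘ₗ π) (fun l l' h => ?_) (fun l x => ?_)
    · refine Subtype.ext (chi_injOn m l.2.1 l'.2.1 (LinearMap.ext fun x => ?_))
      exact LinearMap.congr_fun h ⟨⟨x.1, cartan_le_parabolic r x.2⟩, x.2⟩
    · refine Subtype.ext ?_
      have e := cartan_lie_xb l.2.1 (π x)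
      rw [← hb] at e
      exact e

/-- The inclusion of the invariant subspace extends to the induced module; the image is a nonzero
submodule of a simple module. -/
theorem isAligned_X (hr : IsStrictOrder ι r) (hadm : Admissible r) {m : ι → ℂ}
    (hne : (invExp r m).Nonempty) : IsAligned r (X m) := by
  have hirr := isIrreducible_X m
  refine ⟨hirr, isWeightModule_X m, invSub hr hadm m, inferInstance, inferInstance,
    inferInstance, inferInstance, isInducing_invSub hr hadm hne,
    GenVerma.lift (parabolic r) (invSub hr hadm m).toSubmodule.subtype fun _ _ => rfl, ?_⟩
  obtain ⟨l, hl⟩ := hne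
  rw [← LieModuleHom.range_eq_top]
  refine (IsSimpleOrder.eq_bot_or_eq_top _).resolve_left fun h => xb_ne_zero hl.1 ?_
  rw [← LieSubmodule.mem_bot (R := ℂ) (L := sl ι), ← h, LieModuleHom.mem_range]
  exact ⟨GenVerma.of _ ⟨xb m l, Submodule.subset_span ⟨l, hl, rfl⟩⟩, GenVerma.lift_of _ _ _ _⟩

/-- Shifting exponents by ε_i - ε_j is injective, so no cancellation occurs: the coefficient of E_ij
v at l + ε_i - ε_j is l_j times that of v at l. The relation R is arbitrary so that it can also be ≺
restricted to the first n indices inside sl(∞). -/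
theorem exists_exp_of_killed {m : ι → ℂ} (R : ι → ι → Prop) {v : X m} (hv : v ≠ 0)
    (h : ∀ (i j : ι) (hij : i ≠ j), R i j → ⁅rootVec i j hij, v⁆ = 0) :
    ∃ l ∈ xExp m, ∀ i j, i ≠ j → R i j → l j = 0 ∨ l i = -1 := by
  obtain ⟨⟨l, hl⟩, hlv⟩ : ∃ l, (xBasis m).repr v l ≠ 0 := by
    by_contra! h
    exact hv ((xBasis m).repr.map_eq_zero_iff.mp (Finsupp.ext h))
  refine ⟨l, hl, fun i j hij hR => ?_⟩
  by_contra! hc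
  have hl1 := add_sub_eps_mem_xExp hl hij hc.1 hc.2
  let c (d : xExp m) : X m →ₗ[ℂ] ℂ := Finsupp.lapply d ∘ₗ (xBasis m).repr.toLinearMap
  have hc_self (d : xExp m) : c d (xBasis m d) = 1 := by simp [c]
  have hc_ne {d d' : xExp m} (hd : d' ≠ d) : c d (xBasis m d') = 0 := by simp [c, hd]
  have key : c ⟨_, hl1⟩ ∘ₗ LieModule.toEnd ℂ (sl ι) (X m) (rootVec i j hij) = l j • c ⟨l, hl⟩ := by
    refine (xBasis m).ext fun d => ?_
    rw [LinearMap.comp_apply, LieModule.toEnd_apply_apply, LinearMap.smul_apply, ← xb_coe,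
      rootVec_lie_xb d.2, map_smul]
    by_cases hd : d = ⟨l, hl⟩
    · subst hd
      rw [xb_of_mem hl1, xb_of_mem hl, hc_self, hc_self]
    · rw [xb_coe, hc_ne hd, smul_zero]
      by_cases hd1 : d.1 + eps i - eps j ∈ xExp m
      · rw [xb_of_mem hd1, hc_ne, smul_zero]
        intro e
        have e' : d.1 + eps i - eps j = l + eps i - eps j := congrArg Subtype.val e
        exact hd (Subtype.ext (add_right_cancel (sub_left_injective e')))
      · rw [xb_of_notMem hd1, map_zero, smul_zero]
  have := LinearMap.congr_fun key v
  rw [LinearMap.comp_apply, LieModule.toEnd_apply_apply, h i j hij hR, map_zero,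
    LinearMap.smul_apply] at this
  exact (smul_ne_zero hc.1 hlv) this.symm

end Aligned

/-! ### Compatibility -/

section Compat

variable {ι : Type} [DecidableEq ι] {r : ι → ι → Prop}

theorem add_nsmul_mem_xExp {m : ι → ℂ} {i j : ι} (hi : i ∉ intAll m) (hj : j ∉ intAll m)
    (hij : i ≠ j) (k : ℕ) : m + (k : ℂ) • (eps i - eps j) ∈ xExp m := by
  induction k with
  | zero => rw [Nat.cast_zero, zero_smul, add_zero]; exact self_mem_xExp m
  | succ k ih =>
    have e : m + ((k + 1 : ℕ) : ℂ) • (eps i - eps j) =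
        (m + (k : ℂ) • (eps i - eps j)) + eps i - eps j := by
      push_cast
      rw [add_smul, one_smul]
      abel
    rw [e]
    have hall := intAll_eq_of_sub_mem ih.1
    refine add_sub_eps_mem_xExp ih hij (fun h => ?_) (fun h => ?_)
    · rw [← hall] at hj; exact hj ⟨0, by rw [h, Int.cast_zero]⟩
    · rw [← hall] at hi; exact hi ⟨-1, by rw [h]; norm_num⟩

/-- Nonintegral entries never meet 0 or -1, so the weights μ + k(ε_i - ε_j) occur for all natural k.
Compatibility on I thus says that its elements are pairwise incomparable. -/
theorem not_shadowOrder {m : ι → ℂ} {i j : ι} (hi : i ∉ intAll m) (hj : j ∉ intAll m) :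
    ¬ shadowOrder (X m) i j := by
  rintro ⟨hij, h⟩
  obtain ⟨B, hB⟩ := (h _ (chi_mem_support (self_mem_xExp m))).1
  obtain ⟨k, hk⟩ := exists_nat_gt B
  refine absurd (hB (a := (k : ℝ)) ?_) (not_le.mpr hk)
  change chi m + ((k : ℝ) : ℂ) • root i j ∈ support (cartan ι) (X m)
  rw [Complex.ofReal_natCast, ← chi_add_smul_root]
  exact chi_mem_support (add_nsmul_mem_xExp hi hj hij k)

/-- A relation b ≺ a forces a ∈ Int⁺ or b ∈ Int⁻, so none runs backwards between the three sets or
inside I; admissibility turns what remains into a ≺ b or [a] = [b]. Only the integrality sets of l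
enter, not membership in μ + Q, so truncated exponents qualify. -/
theorem slCompatible_of_exp (hadm : Admissible r) {m l : ι → ℂ}
    (hplus : intPlus l = intPlus m) (hall : intAll l = intAll m)
    (h : ∀ i j, r i j → l j = 0 ∨ l i = -1) : SlCompatible r m := by
  have hminus : intMinus l = intMinus m := by rw [intMinus_eq, intMinus_eq, hplus, hall]
  have h0 {i : ι} (hi : l i = 0) : i ∈ intPlus m := hplus ▸ mem_intPlus_of_eq_zero hi
  have h1 {i : ι} (hi : l i = -1) : i ∈ intMinus m := by
    rw [← hminus]; exact ⟨-1, by norm_num, by rw [hi]; norm_num⟩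
  have hw (A B : Set ι) (hA : ∀ a ∈ A, a ∉ intPlus m) (hB : ∀ b ∈ B, b ∉ intMinus m) :
      WeaklyPrecedes r A B := by
    intro a ha b hb
    by_contra! hc
    by_cases hba : r b a
    · rcases h b a hba with h' | h'
      · exact hA a ha (h0 h')
      · exact hB b hb (h1 h')
    · exact hc.2 (cls_eq_of_incomparable hadm hc.1 hba)
  have hmp : ∀ a ∈ intMinus m, a ∉ intPlus m := fun a ha => by
    rw [intMinus_eq] at ha; exact ha.2
  have hI1 : ∀ a ∈ (intAll m)ᶜ, a ∉ intPlus m := fun a ha h => ha (intPlus_subset_intAll m h)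
  have hI2 : ∀ a ∈ (intAll m)ᶜ, a ∉ intMinus m := fun a ha h => ha (by
    rw [intMinus_eq] at h; exact h.1)
  refine ⟨fun i hi j hj => ⟨fun hij => ?_, fun hs => absurd hs (not_shadowOrder hi hj)⟩,
    hw _ _ hmp hI2, hw _ _ hI1 fun b hb hb' => hmp b hb' hb, hw _ _ hmp fun b hb hb' => hmp b hb' hb⟩
  rcases h i j hij with h' | h'
  · exact absurd (h0 h') (hI1 j hj)
  · exact absurd (h1 h') (hI2 i hi)

end Compat

/-! ### Compatible orders on finite sets -/

section Extremal

variable {ι : Type} [DecidableEq ι] {r : ι → ι → Prop}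

/-- A height function adapted to an order that is compatible with `μ`. -/
theorem SlCompatible.exists_height [Fintype ι] (hr : IsStrictOrder ι r) (hadm : Admissible r)
    {m : ι → ℂ} (hc : SlCompatible r m) :
    ∃ c : ι → ℤ, (∀ i j, r i j → c j < c i) ∧ (∀ i ∈ intMinus m, 0 ≤ c i) ∧
      (∀ i ∈ (intAll m)ᶜ, c i = 0) ∧ ∀ i ∈ intPlus m, c i ≤ 0 := by
  classical
  -- The number of elements above i. It drops strictly along ≺, and by admissibility it agrees on
  -- incomparable elements.
  let rank (i : ι) : ℤ := (Finset.univ.filter fun j => r i j).card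
  have hlt {i j : ι} (h : r i j) : rank j < rank i := by
    refine Nat.cast_lt.mpr (Finset.card_lt_card ((Finset.ssubset_iff_of_subset ?_).mpr ⟨j, ?_, ?_⟩))
    · intro k hk
      exact Finset.mem_filter.mpr ⟨Finset.mem_univ _, hr.trans _ _ _ h (Finset.mem_filter.mp hk).2⟩
    · exact Finset.mem_filter.mpr ⟨Finset.mem_univ _, h⟩
    · exact fun hk => hr.toIrrefl.irrefl j (Finset.mem_filter.mp hk).2
  have hle {i j : ι} (h : ¬ r i j) : rank i ≤ rank j := by
    refine Nat.cast_le.mpr (Finset.card_le_card fun k hk => ?_)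
    exact Finset.mem_filter.mpr ⟨Finset.mem_univ _,
      (hadm.or_of_rel hr (Finset.mem_filter.mp hk).2 j).resolve_left h⟩
  have hprec {A B : Set ι} (hAB : WeaklyPrecedes r A B) {a b : ι} (ha : a ∈ A) (hb : b ∈ B) :
      rank b ≤ rank a := by
    rcases hAB a ha b hb with h | h
    · exact (hlt h).le
    · exact hle (incomparable_of_cls_eq hr h.symm)
  obtain ⟨hI, h1, h2, h3⟩ := hc
  -- The level to be subtracted is the common rank on I; if I is empty, the largest rank on Int⁺; if
  -- that is empty too, 0, since ranks are nonnegative.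
  obtain ⟨t, ht1, ht2, ht3⟩ : ∃ t : ℤ, (∀ i ∈ intMinus m, t ≤ rank i) ∧
      (∀ i ∈ (intAll m)ᶜ, rank i = t) ∧ ∀ i ∈ intPlus m, rank i ≤ t := by
    rcases (intAll m)ᶜ.eq_empty_or_nonempty with hE | ⟨i₀, hi₀⟩
    · rw [hE]
      rcases (intPlus m).eq_empty_or_nonempty with hP | hP
      · rw [hP]
        exact ⟨0, fun i _ => Int.natCast_nonneg _, fun _ h => h.elim, fun _ h => h.elim⟩
      · obtain ⟨b, hb, hmax⟩ := Set.exists_max_image _ rank (Set.toFinite _) hP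
        exact ⟨rank b, fun i hi => hprec h3 hi hb, fun _ h => h.elim, hmax⟩
    · have hinc : ∀ i ∈ (intAll m)ᶜ, ∀ j ∈ (intAll m)ᶜ, ¬ r i j :=
        fun i hi j hj h => not_shadowOrder hi hj ((hI i hi j hj).mp h)
      exact ⟨rank i₀, fun i hi => hprec h1 hi hi₀,
        fun i hi => le_antisymm (hle (hinc i hi i₀ hi₀)) (hle (hinc i₀ hi₀ i hi)),
        fun i hi => hprec h2 hi₀ hi⟩
  exact ⟨fun i => rank i - t, fun i j h => sub_lt_sub_right (hlt h) t,
    fun i hi => sub_nonneg.mpr (ht1 i hi), fun i hi => sub_eq_zero.mpr (ht2 i hi),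
    fun i hi => sub_nonpos.mpr (ht3 i hi)⟩

theorem SlCompatible.invExp_nonempty [Fintype ι] (hr : IsStrictOrder ι r) (hadm : Admissible r)
    {m : ι → ℂ} (hc : SlCompatible r m) : (invExp r m).Nonempty := by
  obtain ⟨c, hc1, hc2, hc3, hc4⟩ := hc.exists_height hr hadm
  -- On Int⁺ one has c_i ≤ 0 ≤ λ_i, on Int⁻ one has λ_i < 0 ≤ c_i, so c_i λ_i ≤ 0 and c_i (λ_i -
  -- μ_i) ≤ -c_i μ_i; elsewhere c_i = 0. The integer displacement f replaces λ_i, which may be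
  -- nonreal.
  have hbd (i : ι) : ∃ B : ℤ, ∀ l ∈ xExp m, ∀ f : ℤ, l i = m i + f → c i * f ≤ B := by
    by_cases hi : i ∈ intAll m
    · by_cases hp : i ∈ intPlus m
      · obtain ⟨k, hk, hmk⟩ := hp
        refine ⟨-(c i * k), fun l hl f hf => ?_⟩
        obtain ⟨k', hk', hlk⟩ : i ∈ intPlus l := by rw [hl.2]; exact ⟨k, hk, hmk⟩
        have e : k' = k + f := by rw [hlk, hmk] at hf; exact_mod_cast hf
        nlinarith [hc4 i ⟨k, hk, hmk⟩]
      · obtain ⟨k, hk, hmk⟩ : i ∈ intMinus m := by rw [intMinus_eq]; exact ⟨hi, hp⟩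
        refine ⟨-(c i * k), fun l hl f hf => ?_⟩
        obtain ⟨k', hk', hlk⟩ : i ∈ intMinus l := by
          rw [intMinus_eq_of_mem_xExp hl]; exact ⟨k, hk, hmk⟩
        have e : k' = k + f := by rw [hlk, hmk] at hf; exact_mod_cast hf
        nlinarith [hc2 i ⟨k, hk, hmk⟩]
    · exact ⟨0, fun l _ f _ => by rw [hc3 i hi, zero_mul]⟩
  choose B hB using hbd
  obtain ⟨z, ⟨l, hl, f, hf, rfl⟩, hmax⟩ := Int.exists_greatest_of_bdd
    (P := fun z => ∃ l ∈ xExp m, ∃ f : ι → ℤ, (∀ i, l i = m i + f i) ∧ ∑ i, c i * f i = z)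
    ⟨∑ i, B i, by
      rintro _ ⟨l, hl, f, hf, rfl⟩
      exact Finset.sum_le_sum fun i _ => hB i l hl _ (hf i)⟩
    ⟨_, m, self_mem_xExp m, 0, fun i => by simp, rfl⟩
  refine ⟨l, hl, fun i j hij => ?_⟩
  by_contra! h
  have hne := rel_ne hr hij
  have hl' := add_sub_eps_mem_xExp hl hne h.1 h.2
  -- The shifted exponent has a larger value, by c_i - c_j > 0.
  have := hmax _ ⟨_, hl', fun k => f k + ((if k = i then 1 else 0) - (if k = j then 1 else 0)),
    fun k => by
      rw [add_sub_assoc, Pi.add_apply, eps_sub_apply, hf]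
      push_cast
      ring, rfl⟩
  simp only [mul_add, mul_sub, Finset.sum_add_distrib, Finset.sum_sub_distrib, mul_ite, mul_one,
    mul_zero, Finset.sum_ite_eq', Finset.mem_univ, if_true] at this
  have := hc1 i j hij
  omega

end Extremal

/-! ### Transport of alignedness -/

section Transport

variable {ι : Type} {r : ι → ι → Prop}
variable {M N : Type} [AddCommGroup M] [Module ℂ M] [LieRingModule (sl ι) M]
  [LieModule ℂ (sl ι) M] [AddCommGroup N] [Module ℂ N] [LieRingModule (sl ι) N]
  [LieModule ℂ (sl ι) N]

/-- A surjection from a simple module onto a nonzero one is an isomorphism, so weight spaces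
correspond and the same S induces N. -/
theorem IsAligned.of_surjective (hM : IsAligned r M) [Nontrivial N] (g : M →ₗ⁅ℂ, sl ι⁆ N)
    (hg : Function.Surjective g) : IsAligned r N := by
  obtain ⟨hirr, ⟨hw1, hw2⟩, S, i1, i2, i3, i4, hS, f, hf⟩ := hM
  have hinj : Function.Injective g := by
    rw [← LieModuleHom.ker_eq_bot]
    refine (IsSimpleOrder.eq_bot_or_eq_top _).resolve_right fun h => ?_
    obtain ⟨v, hv⟩ := exists_ne (0 : N)
    obtain ⟨w, rfl⟩ := hg v
    exact hv (LieModuleHom.mem_ker.mp (h ▸ LieSubmodule.mem_top w))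
  have hweight (χ : Module.Dual ℂ (cartan ι)) : weightSpace (cartan ι) N χ =
      (weightSpace (cartan ι) M χ).map (g : M →ₗ[ℂ] N) := by
    ext v
    obtain ⟨w, rfl⟩ := hg v
    refine Iff.trans ?_ (Function.Injective.mem_set_image (f := g)
      (s := (weightSpace (cartan ι) M χ : Set M)) hinj).symm
    refine forall_congr' fun x => ?_
    rw [← LieModuleHom.map_lie, ← map_smul]
    exact hinj.eq_iff
  refine ⟨?_, ⟨?_, fun χ => ?_⟩, S, i1, i2, i3, i4, hS, g.comp f, hg.comp hf⟩
  · refine LieModule.IsIrreducible.mk fun N' hN' => ?_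
    rcases IsSimpleOrder.eq_bot_or_eq_top (N'.comap g) with h | h
    · refine absurd ((LieSubmodule.eq_bot_iff N').mpr fun v hv => ?_) hN'
      obtain ⟨w, rfl⟩ := hg v
      have : w ∈ N'.comap g := hv
      rw [h, LieSubmodule.mem_bot] at this
      rw [this, map_zero]
    · refine eq_top_iff.mpr fun v _ => ?_
      obtain ⟨w, rfl⟩ := hg v
      have : w ∈ N'.comap g := h ▸ LieSubmodule.mem_top w
      exact this
  · simp only [hweight]
    rw [← Submodule.map_iSup, hw1, Submodule.map_top]
    exact LinearMap.range_eq_top.mpr hg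
  · rw [hweight]
    have := hw2 χ
    infer_instance

theorem sl_induction {p : sl ι → Prop} (h1 : ∀ i j h, p (rootVec i j h)) (h2 : ∀ i j, p (coroot i j))
    (h0 : p 0) (hadd : ∀ A B, p A → p B → p (A + B)) (hsmul : ∀ (c : ℂ) A, p A → p (c • A))
    (A : sl ι) : p A := by
  obtain ⟨A, hA⟩ := A
  refine Submodule.span_induction (p := fun A hA => p ⟨A, hA⟩) ?_ ?_ ?_ ?_ hA
  · rintro _ (⟨i, j, h, rfl⟩ | ⟨i, j, rfl⟩)
    · exact h1 i j h
    · exact h2 i j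
  · exact h0
  · exact fun x y hx hy => hadd ⟨x, hx⟩ ⟨y, hy⟩
  · exact fun c x hx => hsmul c ⟨x, hx⟩

/-- A linear map that commutes with root vectors and coroots is a module homomorphism. -/
def lieHomOfGen (g : M →ₗ[ℂ] N) (h1 : ∀ (i j : ι) h v, g ⁅rootVec i j h, v⁆ = ⁅rootVec i j h, g v⁆)
    (h2 : ∀ (i j : ι) v, g ⁅coroot i j, v⁆ = ⁅coroot i j, g v⁆) : M →ₗ⁅ℂ, sl ι⁆ N where
  __ := g
  map_lie' {A v} := by
    refine sl_induction (p := fun A => ∀ v, g ⁅A, v⁆ = ⁅A, g v⁆) h1 h2 ?_ ?_ ?_ A v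
    · intro v; rw [zero_lie, zero_lie, map_zero]
    · intro A B hA hB v; rw [add_lie, add_lie, map_add, hA, hB]
    · intro c A hA v; rw [smul_lie, smul_lie, map_smul, hA]

end Transport

/-! ### The submodules generated over `sl(n)` -/

section Truncation

variable (μ : ℕ → ℂ) (n : ℕ)

/-- Extension of an exponent in `ℂ^n` by the entries of `μ`. -/
def extendExp (l : Fin n → ℂ) (k : ℕ) : ℂ := if h : k < n then l ⟨k, h⟩ else μ k

theorem extendExp_val (l : Fin n → ℂ) (i : Fin n) : extendExp μ n l i = l i := dif_pos i.2

theorem extendExp_of_le (l : Fin n → ℂ) {k : ℕ} (h : n ≤ k) : extendExp μ n l k = μ k :=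
  dif_neg (not_lt.mpr h)

theorem extendExp_truncate {l : ℕ → ℂ} (h : ∀ k, n ≤ k → l k = μ k) :
    extendExp μ n (truncate l n) = l := by
  funext k
  by_cases hk : k < n
  · exact extendExp_val μ n _ ⟨k, hk⟩
  · rw [extendExp_of_le μ n _ (not_lt.mp hk), h k (not_lt.mp hk)]

theorem extendExp_add_sub (l : Fin n → ℂ) (i j : Fin n) :
    extendExp μ n (l + eps i - eps j) = extendExp μ n l + eps (i : ℕ) - eps (j : ℕ) := by
  funext k
  rw [add_sub_assoc (extendExp μ n l), Pi.add_apply, eps_sub_apply]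
  by_cases hk : k < n
  · have h1 := extendExp_val μ n (l + eps i - eps j) ⟨k, hk⟩
    have h2 := extendExp_val μ n l ⟨k, hk⟩
    rw [h1, h2, add_sub_assoc, Pi.add_apply, eps_sub_apply]
    simp only [Fin.ext_iff]
  · rw [extendExp_of_le μ n _ (not_lt.mp hk), extendExp_of_le μ n _ (not_lt.mp hk),
      if_neg (fun e : k = i => hk (e ▸ i.2)), if_neg (fun e : k = j => hk (e ▸ j.2))]
    simp

theorem extendExp_sub_mem_iff (l : Fin n → ℂ) :
    extendExp μ n l - μ ∈ rootLattice ℕ ↔ l - truncate μ n ∈ rootLattice (Fin n) := by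
  rw [mem_rootLattice_iff, mem_rootLattice_iff]
  constructor
  · rintro ⟨f, hf, hfl⟩
    have hz : ∀ k, n ≤ k → f k = 0 := fun k hk => by
      have := hfl k
      rw [Pi.sub_apply, extendExp_of_le μ n l hk, sub_self] at this
      exact_mod_cast this.symm
    have e : (Finsupp.equivFunOnFinite.symm fun i : Fin n => f i).embDomain Fin.valEmbedding = f := by
      refine Finsupp.ext fun k => ?_
      by_cases hk : k < n
      · exact Finsupp.embDomain_apply_self _ _ (⟨k, hk⟩ : Fin n)
      · rw [hz k (not_lt.mp hk)]
        refine Finsupp.embDomain_of_notMem_range _ _ _ ?_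
        rintro ⟨i, rfl⟩
        exact hk i.2
    refine ⟨Finsupp.equivFunOnFinite.symm fun i : Fin n => f i, ?_, fun i => ?_⟩
    · rw [← e, Finsupp.sum_embDomain] at hf
      exact hf
    · have := hfl i
      rwa [Pi.sub_apply, extendExp_val] at this
  · rintro ⟨f, hf, hfl⟩
    refine ⟨f.embDomain Fin.valEmbedding, by rw [Finsupp.sum_embDomain]; exact hf, fun k => ?_⟩
    by_cases hk : k < n
    · have e := Finsupp.embDomain_apply_self Fin.valEmbedding f (⟨k, hk⟩ : Fin n)
      have e' : f.embDomain Fin.valEmbedding k = f ⟨k, hk⟩ := e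
      rw [e', ← hfl]
      exact congrArg (· - μ k) (extendExp_val μ n l ⟨k, hk⟩)
    · rw [Pi.sub_apply, extendExp_of_le μ n l (not_lt.mp hk), sub_self,
        Finsupp.embDomain_of_notMem_range, Int.cast_zero]
      rintro ⟨i, rfl⟩
      exact hk i.2

theorem extendExp_mem_xExp_iff (l : Fin n → ℂ) :
    extendExp μ n l ∈ xExp μ ↔ l ∈ xExp (truncate μ n) := by
  refine and_congr (extendExp_sub_mem_iff μ n l) ⟨fun h => ?_, fun h => ?_⟩
  · ext i
    have := Set.ext_iff.mp h i
    simp only [intPlus, Set.mem_ofPred_eq, extendExp_val] at this ⊢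
    exact this
  · ext k
    by_cases hk : k < n
    · have := Set.ext_iff.mp h ⟨k, hk⟩
      have e := extendExp_val μ n l ⟨k, hk⟩
      simp only [intPlus, Set.mem_ofPred_eq] at this ⊢
      rw [show extendExp μ n l k = l ⟨k, hk⟩ from e]
      exact this
    · simp only [intPlus, Set.mem_ofPred_eq, extendExp_of_le μ n l (not_lt.mp hk)]

/-- The embedding `X(μ^n) → X(μ)`, as a linear map. -/
def truncLin : X (truncate μ n) →ₗ[ℂ] X μ :=
  (xBasis (truncate μ n)).constr ℂ fun l => xb μ (extendExp μ n l)

/-- Extension preserves and reflects membership in the bases, so the formula persists where both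
sides vanish. Equivariance then reduces to comparing shifts and coefficients. -/
theorem truncLin_xb (l : Fin n → ℂ) : truncLin μ n (xb (truncate μ n) l) = xb μ (extendExp μ n l) := by
  by_cases h : l ∈ xExp (truncate μ n)
  · rw [xb_of_mem h, truncLin, Module.Basis.constr_basis]
  · rw [xb_of_notMem h, xb_of_notMem (fun h' => h ((extendExp_mem_xExp_iff μ n l).mp h')), map_zero]

theorem truncLin_rootVec (i j : Fin n) (h : i ≠ j) (v : X (truncate μ n)) :
    truncLin μ n ⁅rootVec i j h, v⁆ =
      ⁅rootVec (i : ℕ) (j : ℕ) (Fin.val_injective.ne h), truncLin μ n v⁆ := by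
  have key : truncLin μ n ∘ₗ LieModule.toEnd ℂ (sl (Fin n)) (X (truncate μ n)) (rootVec i j h) =
      LieModule.toEnd ℂ (sl ℕ) (X μ) (rootVec (i : ℕ) (j : ℕ) (Fin.val_injective.ne h)) ∘ₗ
        truncLin μ n := by
    refine (xBasis _).ext fun l => ?_
    rw [LinearMap.comp_apply, LinearMap.comp_apply, LieModule.toEnd_apply_apply,
      LieModule.toEnd_apply_apply, ← xb_coe, truncLin_xb, rootVec_lie_xb l.2,
      rootVec_lie_xb ((extendExp_mem_xExp_iff μ n l).mpr l.2), map_smul, truncLin_xb,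
      extendExp_add_sub, extendExp_val]
  exact LinearMap.congr_fun key v

theorem truncLin_coroot (i j : Fin n) (v : X (truncate μ n)) :
    truncLin μ n ⁅coroot i j, v⁆ = ⁅coroot (i : ℕ) (j : ℕ), truncLin μ n v⁆ := by
  have key : truncLin μ n ∘ₗ LieModule.toEnd ℂ (sl (Fin n)) (X (truncate μ n)) (coroot i j) =
      LieModule.toEnd ℂ (sl ℕ) (X μ) (coroot (i : ℕ) (j : ℕ)) ∘ₗ truncLin μ n := by
    refine (xBasis _).ext fun l => ?_
    rw [LinearMap.comp_apply, LinearMap.comp_apply, LieModule.toEnd_apply_apply,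
      LieModule.toEnd_apply_apply, ← xb_coe, truncLin_xb, coroot_lie_xb l.2,
      coroot_lie_xb ((extendExp_mem_xExp_iff μ n l).mpr l.2), map_smul, truncLin_xb,
      extendExp_val, extendExp_val]
  exact LinearMap.congr_fun key v

theorem slIncl_rootVec (i j : Fin n) (h : i ≠ j) :
    slIncl Fin.valEmbedding (rootVec i j h) =
      rootVec (i : ℕ) (j : ℕ) (Fin.val_injective.ne h) :=
  sl.ext (extendEnd_E Fin.valEmbedding i j)

theorem slIncl_coroot (i j : Fin n) :
    slIncl Fin.valEmbedding (coroot i j) = coroot (i : ℕ) (j : ℕ) := by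
  refine sl.ext ?_
  change extendEnd Fin.valEmbedding (E i i - E j j) = E (i : ℕ) (i : ℕ) - E (j : ℕ) (j : ℕ)
  rw [map_sub, extendEnd_E, extendEnd_E]
  rfl

theorem res_rootVec_lie {M : Type} [AddCommGroup M] [Module ℂ M] [LieRingModule (sl ℕ) M]
    [LieModule ℂ (sl ℕ) M] (i j : Fin n) (h : i ≠ j) (v : Res n M) :
    ⁅rootVec i j h, v⁆ =
      (⁅rootVec (i : ℕ) (j : ℕ) (Fin.val_injective.ne h), (show M from v)⁆ : M) := by
  rw [← slIncl_rootVec]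
  rfl

theorem res_coroot_lie {M : Type} [AddCommGroup M] [Module ℂ M] [LieRingModule (sl ℕ) M]
    [LieModule ℂ (sl ℕ) M] (i j : Fin n) (v : Res n M) :
    ⁅coroot i j, v⁆ = (⁅coroot (i : ℕ) (j : ℕ), (show M from v)⁆ : M) := by
  rw [← slIncl_coroot]
  rfl

/-- The embedding `X(μ^n) → X(μ)` of `sl(n)`-modules. -/
def truncHom : X (truncate μ n) →ₗ⁅ℂ, sl (Fin n)⁆ Res n (X μ) :=
  lieHomOfGen (show X (truncate μ n) →ₗ[ℂ] Res n (X μ) from truncLin μ n)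
    (fun i j h v => (truncLin_rootVec μ n i j h v).trans (res_rootVec_lie n i j h _).symm)
    (fun i j v => (truncLin_coroot μ n i j v).trans (res_coroot_lie n i j _).symm)

/-- In this description the images visibly increase with n. -/
theorem mem_range_truncHom_iff (v : X μ) :
    v ∈ (truncHom μ n).range ↔
      ∀ l : xExp μ, (xBasis μ).repr v l ≠ 0 → ∀ k, n ≤ k → l.1 k = μ k := by
  have e : xb μ '' {l | l ∈ xExp μ ∧ ∀ k, n ≤ k → l k = μ k} =
      Set.range fun l : xExp (truncate μ n) => xb μ (extendExp μ n l) := by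
    ext w
    constructor
    · rintro ⟨l, ⟨hl, hk⟩, rfl⟩
      have h := extendExp_truncate μ n hk
      exact ⟨⟨truncate l n, (extendExp_mem_xExp_iff μ n _).mp (by rw [h]; exact hl)⟩,
        congrArg (xb μ) h⟩
    · rintro ⟨l, rfl⟩
      exact ⟨_, ⟨(extendExp_mem_xExp_iff μ n l).mpr l.2, fun k hk => extendExp_of_le μ n l hk⟩, rfl⟩
  have h1 : v ∈ (truncHom μ n).range ↔ v ∈ LinearMap.range (truncLin μ n) := Iff.rfl
  rw [h1, truncLin, Module.Basis.constr_range, ← e, mem_span_xb_iff fun l hl => hl.1]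
  exact forall_congr' fun l => imp_congr_right fun _ => ⟨fun h => h.2, fun h => ⟨l.2, h⟩⟩

theorem isAligned_range_truncHom {r : Fin n → Fin n → Prop}
    (h : IsAligned r (X (truncate μ n))) : IsAligned r (truncHom μ n).range := by
  have hne : Nontrivial (truncHom μ n).range := by
    refine ⟨⟨truncHom μ n (xb _ (truncate μ n)), LieModuleHom.mem_range _ _ |>.mpr ⟨_, rfl⟩⟩, 0,
      fun e => ?_⟩
    have e' : truncLin μ n (xb _ (truncate μ n)) = 0 := congrArg Subtype.val e
    rw [truncLin_xb] at e'
    exact xb_ne_zero ((extendExp_mem_xExp_iff μ n _).mpr (self_mem_xExp _)) e'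
  refine h.of_surjective ((truncHom μ n).codRestrict (truncHom μ n).range
    fun v => (LieModuleHom.mem_range _ _).mpr ⟨v, rfl⟩) ?_
  rintro ⟨w, hw⟩
  obtain ⟨v, rfl⟩ := (LieModuleHom.mem_range _ _).mp hw
  exact ⟨v, rfl⟩

theorem exists_mem_range_truncHom (v : X μ) : ∃ n, 1 ≤ n ∧ v ∈ (truncHom μ n).range := by
  have h (l : xExp μ) : ∃ n, ∀ k, n ≤ k → l.1 k = μ k := by
    obtain ⟨f, -, hf⟩ := mem_rootLattice_iff.mp l.2.1
    obtain ⟨n, hn⟩ := f.support.exists_nat_subset_range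
    refine ⟨n, fun k hk => ?_⟩
    have h0 : f k = 0 := Finsupp.notMem_support_iff.mp fun hk' =>
      absurd (Finset.mem_range.mp (hn hk')) (not_lt.mpr hk)
    have := hf k
    rw [h0, Int.cast_zero, Pi.sub_apply] at this
    exact sub_eq_zero.mp this
  choose N hN using h
  -- Finitely many exponents occur in v, each differing from μ in finitely many places; the added 1
  -- ensures n ≥ 1.
  refine ⟨((xBasis μ).repr v).support.sup N + 1, by omega, (mem_range_truncHom_iff μ _ v).mpr ?_⟩
  intro l hl k hk
  have := Finset.le_sup (f := N) (Finsupp.mem_support_iff.mpr hl)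
  exact hN l k (by omega)

end Truncation

/-! ### Alignedness and compatibility for sl(n), and for sl(n)-submodules of X(μ) -/

theorem isAligned_iff_slCompatible {ι : Type} [DecidableEq ι] [Fintype ι] {r : ι → ι → Prop}
    (hr : IsStrictOrder ι r) (hadm : Admissible r) (m : ι → ℂ) :
    IsAligned r (X m) ↔ SlCompatible r m := by
  constructor
  · intro h
    obtain ⟨v, hv, hk⟩ := h.exists_killed
    obtain ⟨l, hl, h'⟩ := exists_exp_of_killed r hv hk
    exact slCompatible_of_exp hadm hl.2 (intAll_eq_of_sub_mem hl.1)
      fun i j hij => h' i j (rel_ne hr hij) hij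
  · exact fun h => isAligned_X hr hadm (h.invExp_nonempty hr hadm)

theorem intPlus_truncate (m : ℕ → ℂ) (n : ℕ) :
    intPlus (truncate m n) = {i : Fin n | (i : ℕ) ∈ intPlus m} := rfl

theorem intAll_truncate (m : ℕ → ℂ) (n : ℕ) :
    intAll (truncate m n) = {i : Fin n | (i : ℕ) ∈ intAll m} := rfl

/-- The submodule N need not be the standard copy of X(μ^n): a single killed vector in it supplies
the required exponent. -/
theorem slCompatible_of_isAligned_res {r : ℕ → ℕ → Prop} (hr : IsStrictOrder ℕ r)
    (hadm : Admissible r) {μ : ℕ → ℂ} {n : ℕ} (N : LieSubmodule ℂ (sl (Fin n)) (Res n (X μ)))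
    (h : IsAligned (restrictOrder r n) N) : SlCompatible (restrictOrder r n) (truncate μ n) := by
  obtain ⟨⟨v, hvN⟩, hv, hk⟩ := h.exists_killed
  have hv' : (show X μ from v) ≠ 0 := fun e => hv (Subtype.ext e)
  obtain ⟨l, hl, h'⟩ := exists_exp_of_killed (fun i j => i < n ∧ j < n ∧ r i j) hv'
    (by
      rintro i j hij ⟨hi, hj, hrel⟩
      have hij' : (⟨i, hi⟩ : Fin n) ≠ ⟨j, hj⟩ := fun e => hij (congrArg Fin.val e)
      have := congrArg Subtype.val (hk ⟨i, hi⟩ ⟨j, hj⟩ hij' hrel)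
      exact (res_rootVec_lie n ⟨i, hi⟩ ⟨j, hj⟩ hij' v).symm.trans this)
  -- The first n entries of l - μ need not sum to zero, so the truncation need not be an exponent of
  -- X(μ^n); only its integrality sets are needed.
  refine slCompatible_of_exp (l := truncate l n) (admissible_restrictOrder hadm n) ?_ ?_
    fun i j hij => h' i j (rel_ne hr hij) ⟨i.2, j.2, hij⟩
  · rw [intPlus_truncate, intPlus_truncate, hl.2]
  · rw [intAll_truncate, intAll_truncate, intAll_eq_of_sub_mem hl.1]

end SlModules

end

theorem mainTheorem2 (r : ℕ → ℕ → Prop) (hr : IsStrictOrder ℕ r)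
    (hadm : SlModules.Admissible r) (μ : ℕ → ℂ) :
    (SlModules.IsPseudoAligned (SlModules.X μ) r ↔
      SlModules.LocallySlCompatible r μ ∧ ¬ SlModules.IsAligned r (SlModules.X μ)) ∧
    ∀ n : ℕ, 1 ≤ n →
      (SlModules.IsAligned (SlModules.restrictOrder r n) (SlModules.X (SlModules.truncate μ n)) ↔
        SlModules.SlCompatible (SlModules.restrictOrder r n) (SlModules.truncate μ n)) := by
  open SlModules in
  have hfin (n : ℕ) : IsAligned (restrictOrder r n) (X (truncate μ n)) ↔
      SlCompatible (restrictOrder r n) (truncate μ n) :=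
    isAligned_iff_slCompatible (isStrictOrder_restrictOrder hr n)
      (admissible_restrictOrder hadm n) _
  refine ⟨⟨?_, ?_⟩, fun n _ => hfin n⟩
  -- Each aligned N n gives compatibility at level n by itself; nothing about the union is needed.
  · rintro ⟨-, -, hna, N, -, -, hN⟩
    exact ⟨fun n hn => SlModules.slCompatible_of_isAligned_res hr hadm (N n) (hN n hn), hna⟩
  · rintro ⟨hloc, hna⟩
    refine ⟨SlModules.isIrreducible_X μ, SlModules.isWeightModule_X μ, hna,
      fun n => (SlModules.truncHom μ n).range, fun n _ v hv => ?_,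
      SlModules.exists_mem_range_truncHom μ,
      fun n hn => SlModules.isAligned_range_truncHom μ n ((hfin n).mpr (hloc n hn))⟩
    rw [SlModules.mem_range_truncHom_iff] at hv ⊢
    exact fun l hl k hk => hv l hl k (by omega)
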